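/- \textbf{Theorem 1 (Uniform ISS).} Fix $N,M,p\in\mathbb N$ and $t_0\in\mathbb R$. Let $f:\mathbb R^N\times\mathbb R^M\to\mathbb R^N$ be locally Lipschitz, and let $g_1,\dots,g_p:\mathbb R^N\times\mathbb R^M\to\mathbb R^N$ be bounded on bounded sets and continuous at $(0,0)$ (for instance, continuous). For each $i$ let $\mathbb T_i\subset(t_0,\infty)$ be the set of times of a strictly increasing (finite or infinite) sequence without finite accumulation point, where $\mathbb T_1,\dots,\mathbb T_p$ are pairwise disjoint, and put $\mathbb T=\bigcup_i\mathbb T_i$. Consider the impulsive system $$\dot x(t)=f(x(t),u(t))\ \ (t\notin\mathbb T),\qquad x(t)=g_i(x^-(t),u^-(t))\ \ (t\in\mathbb T_i,\ i=1,\dots,p),\tag{1}$$ where $x(t)\in\mathbb R^N$ is absolutely continuous between impulses (and right-continuous at impulse times), the differential equation holds for almost every $t$, $x^-,u^-$ denote left limits, and the input $u:[t_0,\infty)\to\mathbb R^M$ is Lebesgue measurable and locally bounded with left limits at the impulse times. Let $N_i(t,s)$ be the number of elements of $\mathbb T_i$ in $(s,t]$. A function $\gamma:[0,\infty)\to[0,\infty)$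 is of class $\mathcal K$ if it is continuous and strictly increasing with $\gamma(0)=0$, and of class $\mathcal K_\infty$ if moreover it is unbounded; a continuous $\beta:[0,\infty)^2\to[0,\infty)$ is of class $\mathcal{KL}$ if $\beta(\cdot,t)\in\mathcal K$ for every $t\ge0$ and $\beta(r,t)$ decreases to $0$ as $t\to\infty$ for every $r\ge0$. Let $V:\mathbb R^N\to\mathbb R$ be a candidate exponential ISS-Lyapunov function for (1) with rate coefficients $c,d_1,\dots,d_p\in\mathbb R$, $d_i\neq0$; that is, $V$ is locally Lipschitz, positive definite and radially unbounded, and there is $\gamma\in\mathcal K_\infty$ such that, whenever $V(x)\ge\gamma(|u|)$, $$\nabla V(x)\cdot f(x,u)\le -cV(x)\quad\text{for almost all }x\text{ and all }u,$$ $$V(g_i(x,u))\le e^{-d_i}V(x)\quad\text{for all }x,u\text{ and }i=1,\dots,p.$$ For arbitrary $\mu,\lambda>0$ let $\mathcal S[\mu,\lambda]$ be the class of all families $(\mathbb T_1,\dots,\mathbb T_p)$ of impulse times as above that satisfy $$-\sum_{i=1}^p d_iN_i(t,s)-(c-\lambda)(t-s)\le\mu\qquad\text{for all }t\ge s\ge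 t_0.$$ Then (1) is uniformly ISS over $\mathcal S[\mu,\lambda]$: there exist $\beta\in\mathcal{KL}$ and $\gamma\in\mathcal K_\infty$ such that for every $(\mathbb T_1,\dots,\mathbb T_p)\in\mathcal S[\mu,\lambda]$, every initial value $x(t_0)\in\mathbb R^N$ and every input $u$, the corresponding (unique) solution of (1) exists on $[t_0,\infty)$ and satisfies $$|x(t)|\le\max\Big\{\beta(|x(t_0)|,t-t_0),\ \gamma\big(\sup_{s\in[t_0,t]}|u(s)|\big)\Big\}\qquad\text{for all }t\ge t_0.$$ -/

import Mathlib

open Set Filter Topology MeasureTheory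
open scoped NNReal

namespace ImpulsiveISS

/-- Class `K∞`: continuous, strictly increasing, zero at zero and unbounded functions on `[0,∞)`. -/
structure IsClassKInf (α : ℝ≥0 → ℝ≥0) : Prop where
  continuous : Continuous α
  strictMono : StrictMono α
  zero : α 0 = 0
  unbounded : ∀ M : ℝ≥0, ∃ r : ℝ≥0, M ≤ α r

/-- Class `K`: continuous, strictly increasing and zero at zero functions on `[0,∞)`. -/
structure IsClassK (α : ℝ≥0 → ℝ≥0) : Prop where
  continuous : Continuous α
  strictMono : StrictMono α
  zero : α 0 = 0

/-- Class `KL`: jointly continuous, of class `K` in the first variable, and decreasing to zero in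
the second one. -/
structure IsClassKL (β : ℝ≥0 → ℝ≥0 → ℝ≥0) : Prop where
  continuous : Continuous (fun z : ℝ≥0 × ℝ≥0 => β z.1 z.2)
  classK : ∀ t : ℝ≥0, IsClassK (fun r => β r t)
  antitone : ∀ r : ℝ≥0, Antitone (β r)
  tendsto_zero : ∀ r : ℝ≥0, Tendsto (β r) atTop (𝓝 0)

/-- An impulsive system on `ℝ^N` with inputs in `ℝ^M`, with a locally Lipschitz flow map `f` and
`p` jump maps `g i`. -/
structure System (N M p : ℕ) where
  f : EuclideanSpace ℝ (Fin N) → EuclideanSpace ℝ (Fin M) → EuclideanSpace ℝ (Fin N)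
  g : Fin p → EuclideanSpace ℝ (Fin N) → EuclideanSpace ℝ (Fin M) → EuclideanSpace ℝ (Fin N)
  locallyLipschitz_f : LocallyLipschitz
    (fun z : EuclideanSpace ℝ (Fin N) × EuclideanSpace ℝ (Fin M) => f z.1 z.2)

/-- `T i` is the set of times of the `i`-th impulse time sequence: the sequences live in `(t₀,∞)`,
do not accumulate at a finite time (they may be finite or infinite), and no time belongs to two
of them. -/
structure IsImpulseTimes {p : ℕ} (t₀ : ℝ) (T : Fin p → Set ℝ) : Prop where
  subset : ∀ i, T i ⊆ Ioi t₀
  finite : ∀ i t, (T i ∩ Ioc t₀ t).Finite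
  disjoint : ∀ i j, i ≠ j → Disjoint (T i) (T j)

/-- The number of elements of `T` in `(s,t]`. -/
noncomputable def numImpulses (T : Set ℝ) (t s : ℝ) : ℕ := (T ∩ Ioc s t).ncard

/-- The class `S[μ,λ]` of the impulse time sequences that satisfy the dwell-time condition. -/
def dwellClass {p : ℕ} (t₀ c : ℝ) (d : Fin p → ℝ) (μ lam : ℝ) : Set (Fin p → Set ℝ) :=
  {T | IsImpulseTimes t₀ T ∧ ∀ s t : ℝ, t₀ ≤ s → s ≤ t →
    -(∑ i, d i * (numImpulses (T i) t s : ℝ)) - (c - lam) * (t - s) ≤ μ}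

/-- Inputs: Lebesgue measurable and locally bounded on `[t₀,∞)`, with a left limit at every impulse
time (so that the jumps are defined). -/
structure IsInput {M p : ℕ} (t₀ : ℝ) (T : Fin p → Set ℝ)
    (u : ℝ → EuclideanSpace ℝ (Fin M)) : Prop where
  measurable : AEMeasurable u (volume.restrict (Ici t₀))
  bounded : ∀ t : ℝ, ∃ C : ℝ, ∀ s ∈ Icc t₀ t, ‖u s‖ ≤ C
  leftLimit : ∀ i, ∀ t ∈ T i, ∃ v, Tendsto u (𝓝[<] t) (𝓝 v)

/-- `x` is a (Carathéodory) solution on the interval `J` (of the form `[t₀,b)` or `[t₀,∞)`) for the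
input `u` and the impulse times `T`. The interval `(a,b]` in `ac` contains no impulse, but `a` may
be one: so `x` is right-continuous at impulse times. -/
structure System.IsSolutionOn {N M p : ℕ} (S : System N M p) (T : Fin p → Set ℝ)
    (u : ℝ → EuclideanSpace ℝ (Fin M)) (x : ℝ → EuclideanSpace ℝ (Fin N)) (J : Set ℝ) : Prop where
  ac : ∀ a ∈ J, ∀ b ∈ J, a ≤ b → (∀ i, Disjoint (T i) (Ioc a b)) →
    AbsolutelyContinuousOnInterval x a b
  flow : ∀ᵐ t ∂(volume : Measure ℝ), t ∈ J → (∀ i, t ∉ T i) →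
    HasDerivAt x (S.f (x t) (u t)) t
  jump : ∀ i, ∀ t ∈ T i, t ∈ J → ∃ xm um, Tendsto x (𝓝[<] t) (𝓝 xm) ∧
    Tendsto u (𝓝[<] t) (𝓝 um) ∧ x t = S.g i xm um

/-- The supremum norm of `u` on `[t₀,t]`. -/
noncomputable def supNorm {M : ℕ} (u : ℝ → EuclideanSpace ℝ (Fin M)) (t₀ t : ℝ) : ℝ≥0 :=
  ⨆ s : Icc t₀ t, ‖u s‖₊

/-- The system is ISS for the impulse times `T`, with the comparison functions `β` and `γ`: for all
initial values and inputs the solution is global (there is a global solution, and every solution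
on some `[t₀,b)` is a restriction of it) and satisfies the ISS estimate. -/
def System.IsISSWith {N M p : ℕ} (S : System N M p) (t₀ : ℝ) (T : Fin p → Set ℝ)
    (β : ℝ≥0 → ℝ≥0 → ℝ≥0) (γ : ℝ≥0 → ℝ≥0) : Prop :=
  ∀ (x₀ : EuclideanSpace ℝ (Fin N)) (u : ℝ → EuclideanSpace ℝ (Fin M)), IsInput t₀ T u →
    ∃ x : ℝ → EuclideanSpace ℝ (Fin N), x t₀ = x₀ ∧ S.IsSolutionOn T u x (Ici t₀) ∧
      (∀ (b : ℝ) (y : ℝ → EuclideanSpace ℝ (Fin N)), y t₀ = x₀ →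
        S.IsSolutionOn T u y (Ico t₀ b) → EqOn y x (Ico t₀ b)) ∧
      ∀ t : ℝ, t₀ ≤ t →
        ‖x t‖₊ ≤ max (β ‖x t₀‖₊ (t - t₀).toNNReal) (γ (supNorm u t₀ t))

/-- Uniform ISS over a class of impulse time sequences: `β` and `γ` do not depend on the choice of
the sequences from the class. -/
def System.IsUniformlyISSOn {N M p : ℕ} (S : System N M p) (t₀ : ℝ)
    (𝒮 : Set (Fin p → Set ℝ)) : Prop :=
  ∃ (β : ℝ≥0 → ℝ≥0 → ℝ≥0) (γ : ℝ≥0 → ℝ≥0), IsClassKL β ∧ IsClassKInf γ ∧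
    ∀ T ∈ 𝒮, S.IsISSWith t₀ T β γ

/-- `V` is a candidate exponential ISS-Lyapunov function with rate coefficients `c, d 1, …, d p`
(`V` is differentiable almost everywhere, and `fderiv ℝ V x v` is `∇V(x) · v` there). -/
structure System.IsCandidateLyapunov {N M p : ℕ} (S : System N M p)
    (V : EuclideanSpace ℝ (Fin N) → ℝ) (c : ℝ) (d : Fin p → ℝ) : Prop where
  locallyLipschitz : LocallyLipschitz V
  zero : V 0 = 0
  pos : ∀ x, x ≠ 0 → 0 < V x
  radiallyUnbounded : Tendsto V (Bornology.cobounded (EuclideanSpace ℝ (Fin N))) atTop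
  decay : ∃ γ : ℝ≥0 → ℝ≥0, IsClassKInf γ ∧
    (∀ᵐ x ∂(volume : Measure (EuclideanSpace ℝ (Fin N))), ∀ u : EuclideanSpace ℝ (Fin M),
      (γ ‖u‖₊ : ℝ) ≤ V x → fderiv ℝ V x (S.f x u) ≤ -c * V x) ∧
    (∀ (i : Fin p) (x : EuclideanSpace ℝ (Fin N)) (u : EuclideanSpace ℝ (Fin M)),
      (γ ‖u‖₊ : ℝ) ≤ V x → V (S.g i x u) ≤ Real.exp (-(d i)) * V x)

end ImpulsiveISS

/-! ### Absolutely continuous functions -/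

/-! Let D(t,s) = ∑ dᵢ Nᵢ(t,s) + c (t - s) (`decayExponent`) and let r bound the input. While V
exceeds the threshold γ(r), the flow multiplies V by at most exp(-c · elapsed time) and an impulse
of type i by at most exp(-dᵢ). Since D is additive in time, these factors multiply to exp(-D). Hence
either V(x(t)) ≤ exp(-D(t,t₀)) V(x₀), or V(x(t)) ≤ exp(-D(t,s)) R for some s at which the trajectory
was at the threshold or had just jumped from below it. Here R is the maximum of γ(r) and a bound for
V after such jumps (`exists_isClassKInf_jump_le`). The alternative is propagated through the
impulses in `System.exists_solution_Icc`.

The dwell-time condition says precisely that exp(-D(t,s)) ≤ exp(μ - λ (t - s)), whatever the signs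
of c and dᵢ. The first case thus gives β, and the second gives the gain, after comparing V with the
norm by functions of class K∞.

Two points need care. The decay of V is known at almost all states only, and a trajectory may stay
in the exceptional null set. Fubini on lines with a fixed direction, followed by continuity, gives a
one-sided directional bound at every state above the threshold
(`LocallyLipschitz.exists_sub_le_of_ae_fderiv_le`), and this bounds the derivative of V along
trajectories (`LocallyLipschitz.deriv_comp_le_of_ae_fderiv_le`). Global existence comes from a
cutoff of the vector field: the Lyapunov estimate also holds for the cut-off flow and confines it to
the region where the cutoff equals one (`exists_solution_of_lyapunov`). -/

theorem LipschitzOnWith.comp_absolutelyContinuousOnInterval {X Y : Type*} [PseudoMetricSpace X]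
    [PseudoMetricSpace Y] {φ : X → Y} {f : ℝ → X} {K : ℝ≥0} {s : Set X} {a b : ℝ}
    (hφ : LipschitzOnWith K φ s) (hf : AbsolutelyContinuousOnInterval f a b)
    (hs : MapsTo f (uIcc a b) s) :
    AbsolutelyContinuousOnInterval (fun t => φ (f t)) a b := by
  rw [absolutelyContinuousOnInterval_iff] at hf ⊢
  intro ε hε
  obtain ⟨δ, hδ, h⟩ := hf (ε / (K + 1)) (by positivity)
  refine ⟨δ, hδ, fun E hE hE' => ?_⟩
  have hlt := h E hE hE'
  have hle : ∑ i ∈ Finset.range E.1, dist (φ (f (E.2 i).1)) (φ (f (E.2 i).2)) ≤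
      K * ∑ i ∈ Finset.range E.1, dist (f (E.2 i).1) (f (E.2 i).2) := by
    rw [Finset.mul_sum]
    refine Finset.sum_le_sum fun i hi => ?_
    have hmem := hE.1 i hi
    exact hφ.dist_le_mul _ (hs hmem.1) _ (hs hmem.2)
  have hnn : 0 ≤ ∑ i ∈ Finset.range E.1, dist (f (E.2 i).1) (f (E.2 i).2) :=
    Finset.sum_nonneg fun _ _ => dist_nonneg
  have hK : (0 : ℝ) < K + 1 := by positivity
  rw [lt_div_iff₀ hK] at hlt
  nlinarith

theorem AbsolutelyContinuousOnInterval.congr {X : Type*} [PseudoMetricSpace X] {f g : ℝ → X}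
    {a b : ℝ} (hf : AbsolutelyContinuousOnInterval f a b) (h : EqOn f g (uIcc a b)) :
    AbsolutelyContinuousOnInterval g a b := by
  rw [absolutelyContinuousOnInterval_iff] at hf ⊢
  intro ε hε
  obtain ⟨δ, hδ, h'⟩ := hf ε hε
  refine ⟨δ, hδ, fun E hE hE' => lt_of_eq_of_lt ?_ (h' E hE hE')⟩
  refine Finset.sum_congr rfl fun i hi => ?_
  have hmem := hE.1 i hi
  rw [h hmem.1, h hmem.2]

theorem AbsolutelyContinuousOnInterval.le_of_deriv_nonpos {v : ℝ → ℝ} {a b : ℝ} (hab : a ≤ b)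
    (hv : AbsolutelyContinuousOnInterval v a b)
    (hd : ∀ᵐ t, t ∈ Icc a b → ∀ v', HasDerivAt v v' t → v' ≤ 0) : v b ≤ v a := by
  have hint := hv.integral_deriv_eq_sub
  have hle : ∫ x in a..b, deriv v x ≤ 0 := by
    have : 0 ≤ ∫ x in a..b, -deriv v x := by
      apply intervalIntegral.integral_nonneg_of_ae_restrict hab
      rw [EventuallyLE, ae_restrict_iff' measurableSet_Icc]
      filter_upwards [hd, hv.ae_differentiableAt] with t h1 h2 ht
      have := h1 ht _ (h2 (by rwa [uIcc_of_le hab])).hasDerivAt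
      simpa using this
    rw [intervalIntegral.integral_neg] at this
    linarith
  linarith

/-- Grönwall's inequality for absolutely continuous functions. -/
theorem AbsolutelyContinuousOnInterval.le_exp_mul {v : ℝ → ℝ} {a b K : ℝ} (hab : a ≤ b)
    (hv : AbsolutelyContinuousOnInterval v a b)
    (hd : ∀ᵐ t, t ∈ Icc a b → ∀ v', HasDerivAt v v' t → v' ≤ K * v t) :
    v b ≤ Real.exp (K * (b - a)) * v a := by
  -- Integrating factor, normalized by e(a) = 1: the derivative of e v is e (v' - K v) ≤ 0.
  set e : ℝ → ℝ := fun t => Real.exp (-(K * (t - a))) with he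
  have hde : ∀ t, HasDerivAt e (-K * e t) t := by
    intro t
    have h1 : HasDerivAt (fun t : ℝ => -(K * (t - a))) (-(K * 1)) t :=
      (((hasDerivAt_id t).sub_const a).const_mul K).neg
    convert! h1.exp using 1
    ring
  have hce : ContDiff ℝ 1 e := by fun_prop
  have hac : AbsolutelyContinuousOnInterval (e * v) a b :=
    hce.contDiffOn.absolutelyContinuousOnInterval.mul hv
  have hle := hac.le_of_deriv_nonpos hab (by
    filter_upwards [hd, hv.ae_differentiableAt] with t h1 h2 ht w hw
    have hdv := (h2 (by rwa [uIcc_of_le hab])).hasDerivAt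
    rw [hw.unique ((hde t).mul hdv)]
    have h3 := h1 ht _ hdv
    have hpos : 0 < e t := Real.exp_pos _
    nlinarith)
  have hle' : Real.exp (-(K * (b - a))) * v b ≤ v a := by simpa [he] using hle
  calc v b = Real.exp (K * (b - a)) * (Real.exp (-(K * (b - a))) * v b) := by
        rw [← mul_assoc, ← Real.exp_add]; simp
    _ ≤ _ := by gcongr

/-- If `v' ≤ K v` wherever `v > ρ`, then `v` grows at most exponentially since the initial time or
since the last time at which `v ≤ ρ`. -/
theorem AbsolutelyContinuousOnInterval.le_exp_mul_or_exists {v : ℝ → ℝ} {a b K ρ : ℝ}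
    (hab : a ≤ b) (hv : AbsolutelyContinuousOnInterval v a b)
    (hd : ∀ᵐ t, t ∈ Icc a b → ρ < v t → ∀ v', HasDerivAt v v' t → v' ≤ K * v t) :
    v b ≤ Real.exp (K * (b - a)) * v a ∨
      ∃ τ ∈ Icc a b, v b ≤ Real.exp (K * (b - τ)) * ρ := by
  by_cases hne : (Icc a b ∩ v ⁻¹' Iic ρ).Nonempty
  · right
    have hcont : ContinuousOn v (Icc a b) := by simpa [uIcc_of_le hab] using hv.continuousOn
    have hclosed : IsClosed (Icc a b ∩ v ⁻¹' Iic ρ) :=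
      hcont.preimage_isClosed_of_isClosed isClosed_Icc isClosed_Iic
    obtain ⟨τ, ⟨hτ, hτρ⟩, hmax⟩ :=
      (isCompact_Icc.of_isClosed_subset hclosed inter_subset_left).exists_isGreatest hne
    refine ⟨τ, hτ, ?_⟩
    have hv' : AbsolutelyContinuousOnInterval v τ b := hv.mono (by
      rw [uIcc_of_le hab, uIcc_of_le hτ.2]; exact Icc_subset_Icc_left hτ.1)
    have hle := hv'.le_exp_mul (K := K) hτ.2 (by
      -- After τ the strict inequality ρ < v holds by maximality; it fails at τ itself, which is a
      -- null set.
      have hne : ∀ᵐ t : ℝ, t ≠ τ := by simp [ae_iff, measure_singleton]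
      filter_upwards [hd, hne] with t h1 h2 ht
      have ht' : t ∈ Icc a b := ⟨hτ.1.trans ht.1, ht.2⟩
      refine h1 ht' ?_
      by_contra! hcon
      exact h2 (le_antisymm (hmax ⟨ht', hcon⟩) ht.1))
    exact hle.trans (mul_le_mul_of_nonneg_left hτρ (Real.exp_pos _).le)
  · left
    refine hv.le_exp_mul hab ?_
    filter_upwards [hd] with t h1 ht
    refine h1 ht ?_
    by_contra! hcon
    exact hne ⟨t, ht, hcon⟩

namespace ImpulsiveISS

/-! ### Comparison functions -/

theorem IsClassKInf.isClassK {α : ℝ≥0 → ℝ≥0} (h : IsClassKInf α) : IsClassK α :=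
  ⟨h.continuous, h.strictMono, h.zero⟩

theorem IsClassKInf.comp {α β : ℝ≥0 → ℝ≥0} (hα : IsClassKInf α) (hβ : IsClassKInf β) :
    IsClassKInf (fun r => α (β r)) := by
  refine ⟨hα.continuous.comp hβ.continuous, hα.strictMono.comp hβ.strictMono,
    by rw [hβ.zero, hα.zero], fun M => ?_⟩
  obtain ⟨s, hs⟩ := hα.unbounded M
  obtain ⟨r, hr⟩ := hβ.unbounded s
  exact ⟨r, hs.trans (hα.strictMono.monotone hr)⟩

theorem isClassKInf_const_mul {k : ℝ≥0} (hk : 0 < k) : IsClassKInf (fun r => k * r) := by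
  refine ⟨by fun_prop, fun a b h => mul_lt_mul_of_pos_left h hk, by simp, fun M => ⟨k⁻¹ * M, ?_⟩⟩
  rw [mul_inv_cancel_left₀ hk.ne']

theorem IsClassKInf.max {α β : ℝ≥0 → ℝ≥0} (hα : IsClassKInf α) (hβ : IsClassKInf β) :
    IsClassKInf (fun r => Max.max (α r) (β r)) := by
  refine ⟨hα.continuous.max hβ.continuous, fun a b h => max_lt_max (hα.strictMono h)
    (hβ.strictMono h), by simp [hα.zero, hβ.zero], fun M => ?_⟩
  obtain ⟨r, hr⟩ := hα.unbounded M
  exact ⟨r, hr.trans (le_max_left _ _)⟩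

/-- A nondecreasing function that is nonnegative and tends to zero at zero is majorized by a
function of class `K∞`. -/
theorem exists_isClassKInf_ge_of_monotone {φ : ℝ → ℝ} (hφ : Monotone φ) (hnn : ∀ r, 0 ≤ φ r)
    (h0 : Tendsto φ (𝓝 0) (𝓝 0)) :
    ∃ α, IsClassKInf α ∧ ∀ r : ℝ≥0, φ r ≤ α r := by
  have hii : ∀ a b : ℝ, IntervalIntegrable φ volume a b := fun a b => hφ.intervalIntegrable
  have hmul : ∀ r : ℝ, 0 ≤ r → Monotone fun s => φ (r * s) :=
    fun r hr => hφ.comp (monotone_mul_left_of_nonneg hr)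
  -- Averaging makes φ continuous: for r > 0, m(r) = r⁻¹ ∫_r^{2r} φ. By monotonicity φ(r) ≤ m(r) ≤
  -- φ(2r), which gives the majorization and also continuity at 0.
  set m : ℝ → ℝ := fun r => ∫ s in (1 : ℝ)..2, φ (r * s) with hm
  have hmnn : ∀ r, 0 ≤ m r := fun r => intervalIntegral.integral_nonneg (by norm_num)
    fun s _ => hnn _
  have hlow : ∀ r : ℝ, 0 ≤ r → φ r ≤ m r := by
    intro r hr
    have : ∫ s in (1 : ℝ)..2, φ r ≤ m r := by
      refine intervalIntegral.integral_mono_on (by norm_num) (by simp)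
        (hmul r hr).intervalIntegrable fun s hs => hφ ?_
      nlinarith [hs.1]
    norm_num at this
    exact this
  have hup : ∀ r : ℝ, 0 ≤ r → m r ≤ φ (r * 2) := by
    intro r hr
    have : m r ≤ ∫ s in (1 : ℝ)..2, φ (r * 2) := by
      refine intervalIntegral.integral_mono_on (by norm_num)
        (hmul r hr).intervalIntegrable (by simp) fun s hs => hφ ?_
      nlinarith [hs.2]
    norm_num at this
    exact this
  have hmono : ∀ r s : ℝ, 0 ≤ r → r ≤ s → m r ≤ m s := by
    intro r s hr hrs
    refine intervalIntegral.integral_mono_on (by norm_num)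
        (hmul r hr).intervalIntegrable (hmul s (hr.trans hrs)).intervalIntegrable fun t ht => hφ ?_
    nlinarith [ht.1]
  have hprim : Continuous fun x => ∫ t in (0 : ℝ)..x, φ t :=
    intervalIntegral.continuous_primitive hii 0
  have hcont : ∀ r : ℝ≥0, ContinuousAt (fun r : ℝ≥0 => m r) r := by
    intro r
    rcases eq_or_lt_of_le (zero_le : 0 ≤ r) with h | h
    · subst h
      have hm0 : m 0 = 0 := by
        have : φ 0 = 0 := tendsto_nhds_unique (tendsto_pure_nhds φ 0) (h0.mono_left (pure_le_nhds 0))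
        simp [hm, this]
      rw [ContinuousAt, NNReal.coe_zero, hm0]
      have hlim : Tendsto (fun r : ℝ≥0 => φ ((r : ℝ) * 2)) (𝓝 0) (𝓝 0) := by
        refine h0.comp ?_
        have : Continuous fun r : ℝ≥0 => (r : ℝ) * 2 := by fun_prop
        simpa using this.tendsto 0
      exact tendsto_of_tendsto_of_tendsto_of_le_of_le tendsto_const_nhds hlim
        (fun r => hmnn r) fun r => hup r r.2
    · have hr : (0 : ℝ) < r := h
      have hF : ContinuousAt (fun r : ℝ => r⁻¹ * ((∫ t in (0 : ℝ)..r * 2, φ t) -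
          ∫ t in (0 : ℝ)..r, φ t)) r := by
        refine (continuousAt_inv₀ hr.ne').mul (ContinuousAt.sub ?_ hprim.continuousAt)
        exact (hprim.comp (continuous_mul_const (2 : ℝ))).continuousAt
      have heq : (fun r : ℝ => r⁻¹ * ((∫ t in (0 : ℝ)..r * 2, φ t) -
          ∫ t in (0 : ℝ)..r, φ t)) =ᶠ[𝓝 (r : ℝ)] m := by
        filter_upwards [lt_mem_nhds hr] with x hx
        rw [hm]
        simp only
        rw [intervalIntegral.integral_comp_mul_left φ hx.ne', smul_eq_mul, mul_one,
          intervalIntegral.integral_interval_sub_left (hii _ _) (hii _ _)]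
      exact (hF.congr heq).comp NNReal.continuous_coe.continuousAt
  -- The summand r provides strict monotonicity and unboundedness.
  refine ⟨fun r => r + (m r).toNNReal, ⟨?_, ?_, ?_, fun M => ⟨M, le_self_add⟩⟩, fun r => ?_⟩
  · refine continuous_id.add (continuous_real_toNNReal.comp ?_)
    exact continuous_iff_continuousAt.2 hcont
  · intro a b hab
    exact add_lt_add_of_lt_of_le hab (Real.toNNReal_le_toNNReal (hmono _ _ a.2 hab.le))
  · have : φ 0 = 0 := tendsto_nhds_unique (tendsto_pure_nhds φ 0) (h0.mono_left (pure_le_nhds 0))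
    simp [hm, this]
  · rw [NNReal.coe_add, Real.coe_toNNReal _ (hmnn r)]
    exact (hlow r r.2).trans (le_add_of_nonneg_left r.2)

/-- If `B` is bounded on the sublevel sets of `A` and small where `A` is small, then `B ≤ α ∘ A`
for a function `α` of class `K∞`. -/
theorem exists_isClassKInf_comp_ge {X : Type*} (A B : X → ℝ≥0)
    (hbdd : ∀ r : ℝ≥0, ∃ C : ℝ≥0, ∀ x, A x ≤ r → B x ≤ C)
    (hzero : ∀ ε : ℝ≥0, 0 < ε → ∃ δ : ℝ≥0, 0 < δ ∧ ∀ x, A x ≤ δ → B x ≤ ε) :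
    ∃ α, IsClassKInf α ∧ ∀ x, B x ≤ α (A x) := by
  -- The supremum of the empty set is 0 in `ℝ≥0`, so empty sublevel sets do no harm.
  set φ : ℝ≥0 → ℝ≥0 := fun r => sSup (B '' {x | A x ≤ r}) with hφ
  have hba : ∀ r, BddAbove (B '' {x | A x ≤ r}) := by
    intro r
    obtain ⟨C, hC⟩ := hbdd r
    exact ⟨C, by rintro _ ⟨x, hx, rfl⟩; exact hC x hx⟩
  have hle : ∀ x, B x ≤ φ (A x) := fun x => le_csSup (hba _) ⟨x, le_refl (A x), rfl⟩
  have hub : ∀ r C, (∀ x, A x ≤ r → B x ≤ C) → φ r ≤ C := by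
    intro r C h
    rcases (B '' {x | A x ≤ r}).eq_empty_or_nonempty with he | hne
    · simp [hφ, he]
    · exact csSup_le hne (by rintro _ ⟨x, hx, rfl⟩; exact h x hx)
  have hmono : Monotone φ := by
    intro r s hrs
    exact hub r _ fun x hx => le_csSup (hba s) ⟨x, le_trans hx hrs, rfl⟩
  obtain ⟨α, hα, hge⟩ := exists_isClassKInf_ge_of_monotone
    (φ := fun r : ℝ => (φ r.toNNReal : ℝ))
    (fun r s h => NNReal.coe_le_coe.2 (hmono (Real.toNNReal_le_toNNReal h)))
    (fun r => NNReal.coe_nonneg _) (by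
      rw [Metric.tendsto_nhds]
      intro ε hε
      obtain ⟨δ, hδ, h⟩ := hzero (ε / 2).toNNReal (by simpa using hε)
      filter_upwards [gt_mem_nhds (show (0 : ℝ) < δ from hδ)] with r hr
      have h1 : φ r.toNNReal ≤ (ε / 2).toNNReal := by
        refine hub _ _ fun x hx => h x (hx.trans ?_)
        rw [Real.toNNReal_le_iff_le_coe]
        exact hr.le
      have h2 : (φ r.toNNReal : ℝ) ≤ ε / 2 := by
        have := NNReal.coe_le_coe.2 h1
        rwa [Real.coe_toNNReal _ (by positivity)] at this
      rw [Real.dist_eq, sub_zero, abs_of_nonneg (NNReal.coe_nonneg _)]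
      linarith)
  refine ⟨α, hα, fun x => (hle x).trans ?_⟩
  have := hge (A x)
  simpa using this

end ImpulsiveISS

/-! ### Carathéodory solutions of differential equations -/

/-- Existence of a Carathéodory solution of `z' = F(t,z)` on `[a,b]`, for a bounded right-hand side
that is measurable in time and Lipschitz in space. -/
theorem exists_caratheodory_solution {E : Type*} [NormedAddCommGroup E] [NormedSpace ℝ E]
    [CompleteSpace E] {F : ℝ → E → E} {a b : ℝ} (hab : a ≤ b) {K : ℝ≥0} {B : ℝ}
    (hLip : ∀ s ∈ Icc a b, LipschitzWith K (F s)) (hB : ∀ s ∈ Icc a b, ∀ x, ‖F s x‖ ≤ B)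
    (hmeas : ∀ z : ℝ → E, Continuous z →
      AEStronglyMeasurable (fun s => F s (z s)) (volume.restrict (Icc a b))) (xa : E) :
    ∃ z : ℝ → E, z a = xa ∧ AbsolutelyContinuousOnInterval z a b ∧
      ∀ᵐ t, t ∈ Icc a b → HasDerivAt z (F t (z t)) t := by
  have hint : ∀ z : C(Icc a b, E),
      IntervalIntegrable (fun s => F s (IccExtend hab z s)) volume a b := by
    intro z
    rw [intervalIntegrable_iff_integrableOn_Icc_of_le hab]
    refine Integrable.of_bound (hmeas _ z.continuous.Icc_extend') B ?_
    rw [ae_restrict_iff' measurableSet_Icc]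
    exact Eventually.of_forall fun s hs => hB s hs _
  have hsub : ∀ (z : C(Icc a b, E)) (s t : ℝ), s ∈ Icc a b → t ∈ Icc a b →
      IntervalIntegrable (fun s => F s (IccExtend hab z s)) volume s t := fun z s t hs ht =>
    (hint z).mono_set (by rw [uIcc_of_le hab]; exact uIcc_subset_Icc hs ht)
  have hcont : ∀ z : C(Icc a b, E),
      Continuous fun t : Icc a b => xa + ∫ s in a..t, F s (IccExtend hab z s) := by
    intro z
    have h := intervalIntegral.continuousOn_primitive_interval' (hint z) left_mem_uIcc
    rw [uIcc_of_le hab, continuousOn_iff_continuous_domRestrict] at h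
    exact continuous_const.add h
  let next : C(Icc a b, E) → C(Icc a b, E) := fun z => ⟨_, hcont z⟩
  have hnext : ∀ z t, next z t = xa + ∫ s in a..t, F s (IccExtend hab z s) := fun _ _ => rfl
  -- The n-th Picard iterate has Lipschitz constant at most (K (b - a))ⁿ / n!, which is below 1 for
  -- large n. So one fixed point argument covers all of [a,b], with no smallness condition on its
  -- length.
  have hiter : ∀ (α β : C(Icc a b, E)) (n : ℕ) (t : Icc a b),
      dist (next^[n] α t) (next^[n] β t) ≤
        ((K : ℝ) * (t - a)) ^ n / (n.factorial : ℝ) * dist α β := by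
    intro α β n
    induction n with
    | zero => intro t; simpa using ContinuousMap.dist_apply_le_dist t
    | succ n ih =>
      intro t
      have hat : a ∈ Icc a b := left_mem_Icc.2 hab
      rw [Function.iterate_succ_apply', Function.iterate_succ_apply', hnext, hnext, dist_add_left,
        dist_eq_norm, ← intervalIntegral.integral_sub (hsub _ _ _ hat t.2) (hsub _ _ _ hat t.2)]
      have hint_pow : ∫ s in a..(t : ℝ), (s - a) ^ n = (t - a) ^ (n + 1) / (n + 1) := by
        rw [intervalIntegral.integral_comp_sub_right (fun s => s ^ n) a, integral_pow]
        simp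
      calc ‖∫ s in a..(t : ℝ), (F s (IccExtend hab (next^[n] α) s) -
              F s (IccExtend hab (next^[n] β) s))‖
          ≤ ∫ s in a..(t : ℝ), (K : ℝ) ^ (n + 1) / (n.factorial : ℝ) * dist α β * (s - a) ^ n := by
            refine intervalIntegral.norm_integral_le_of_norm_le t.2.1 ?_
              (Continuous.intervalIntegrable (by fun_prop) _ _)
            refine Eventually.of_forall fun s hs => ?_
            have hs' : s ∈ Icc a b := ⟨hs.1.le, hs.2.trans t.2.2⟩
            rw [← dist_eq_norm]
            refine ((hLip s hs').dist_le_mul _ _).trans ?_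
            rw [IccExtend_of_mem hab _ hs', IccExtend_of_mem hab _ hs']
            refine (mul_le_mul_of_nonneg_left (ih ⟨s, hs'⟩) K.2).trans (le_of_eq ?_)
            simp only [NNReal.val_eq_coe, mul_pow]
            ring
        _ = _ := by
            rw [intervalIntegral.integral_const_mul, hint_pow, Nat.factorial_succ, mul_pow]
            push_cast
            field_simp
  obtain ⟨n, hn⟩ := (FloorSemiring.tendsto_pow_div_factorial_atTop ((K : ℝ) * (b - a))
    |>.eventually (gt_mem_nhds zero_lt_one)).exists
  have hba : 0 ≤ b - a := sub_nonneg.2 hab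
  have hC : (0 : ℝ) ≤ ((K : ℝ) * (b - a)) ^ n / (n.factorial : ℝ) := by positivity
  have hcontr : ContractingWith (((K : ℝ) * (b - a)) ^ n / (n.factorial : ℝ)).toNNReal next^[n] := by
    refine ⟨by simpa using hn, LipschitzWith.of_dist_le_mul fun α β => ?_⟩
    rw [Real.coe_toNNReal _ hC, ContinuousMap.dist_le (by positivity)]
    intro t
    refine (hiter α β n t).trans (mul_le_mul_of_nonneg_right ?_ dist_nonneg)
    have h0 : 0 ≤ (t : ℝ) - a := sub_nonneg.2 t.2.1
    have h1 : (t : ℝ) - a ≤ b - a := sub_le_sub_right t.2.2 a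
    gcongr
  have : Nonempty C(Icc a b, E) := ⟨ContinuousMap.const _ xa⟩
  obtain ⟨z, hz⟩ : ∃ z, Function.IsFixedPt next z := ⟨_, hcontr.isFixedPt_fixedPoint_iterate⟩
  set w : ℝ → E := fun t => xa + ∫ s in a..t, F s (IccExtend hab z s) with hw
  have hwz : ∀ t ∈ Icc a b, IccExtend hab z t = w t := by
    intro t ht
    rw [IccExtend_of_mem hab _ ht]
    conv_lhs => rw [← hz.eq]
    exact hnext z ⟨t, ht⟩
  refine ⟨w, by simp [hw], ?_, ?_⟩
  · refine LipschitzOnWith.absolutelyContinuousOnInterval (K := B.toNNReal) ?_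
    rw [uIcc_of_le hab]
    refine LipschitzOnWith.of_dist_le_mul fun s hs t ht => ?_
    have hat : a ∈ Icc a b := left_mem_Icc.2 hab
    rw [hw]
    simp only
    rw [dist_add_left, dist_eq_norm, intervalIntegral.integral_interval_sub_left
      (hsub _ _ _ hat hs) (hsub _ _ _ hat ht), Real.dist_eq]
    refine (intervalIntegral.norm_integral_le_of_norm_le_const (C := B) fun r hr => ?_).trans
      (mul_le_mul_of_nonneg_right (Real.le_coe_toNNReal B) (abs_nonneg _))
    exact hB r (uIcc_subset_Icc ht hs (uIoc_subset_uIcc hr)) _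
  · filter_upwards [(hint z).ae_hasDerivAt_integral] with t ht htm
    have h := ht (by rwa [uIcc_of_le hab]) a left_mem_uIcc
    rw [hwz t htm] at h
    exact h.const_add xa

/-! ### Locally Lipschitz functions along trajectories -/

section Clarke

variable {E F : Type*} [NormedAddCommGroup E] [NormedSpace ℝ E] [FiniteDimensional ℝ E]
  [MeasurableSpace E] [BorelSpace E] {ν : Measure E} [ν.IsAddHaarMeasure]

/-- If the derivative of a Lipschitz function in the direction `v` is at most `m` almost
everywhere on a ball, then `V (x + h • v) - V x ≤ h * m` inside of this ball. -/
theorem LipschitzOnWith.sub_le_of_ae_fderiv_le {V : E → ℝ} {L : ℝ≥0} {δ m : ℝ} {x v : E}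
    (hL : LipschitzOnWith L V (Metric.ball x δ))
    (hd : ∀ᵐ y ∂ν, y ∈ Metric.ball x δ → fderiv ℝ V y v ≤ m) {h : ℝ} (h0 : 0 ≤ h)
    (hh : h * ‖v‖ < δ) : V (x + h • v) - V x ≤ h * m := by
  have hae : ∀ᵐ y ∂ν, y ∈ Metric.ball x δ → DifferentiableAt ℝ V y ∧ fderiv ℝ V y v ≤ m := by
    filter_upwards [hd, hL.ae_differentiableWithinAt_of_mem (μ := ν)] with y h1 h2 hy
    exact ⟨(h2 hy).differentiableAt (Metric.isOpen_ball.mem_nhds hy), h1 hy⟩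
  obtain ⟨s, hs, hsm, hsp⟩ := hae.exists_measurable_mem
  -- Fubini: for almost every base point y, almost every point of the line y + ℝ v lies in the good
  -- set. Along such lines the derivative bound can be integrated.
  have hline := (ae_ae_add_linearMap_mem_iff (LinearMap.toSpanSingleton ℝ E v)
    (volume : Measure ℝ) ν hsm).2 hs
  have hball : ∀ y ∈ Metric.ball x (δ - h * ‖v‖), ∀ r ∈ Icc 0 h, y + r • v ∈ Metric.ball x δ := by
    intro y hy r hr
    rw [Metric.mem_ball, dist_eq_norm] at hy ⊢
    calc ‖y + r • v - x‖ = ‖(y - x) + r • v‖ := by congr 1; abel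
      _ ≤ ‖y - x‖ + ‖r • v‖ := norm_add_le _ _
      _ ≤ ‖y - x‖ + h * ‖v‖ := by
        rw [norm_smul, Real.norm_of_nonneg hr.1]
        gcongr
        exact hr.2
      _ < δ := by linarith
  have hgood : ∀ᵐ y ∂ν, y ∈ Metric.ball x (δ - h * ‖v‖) → V (y + h • v) - V y ≤ h * m := by
    filter_upwards [hline] with y hy hyb
    have hlipline : LipschitzOnWith ‖v‖₊ (fun r : ℝ => y + r • v) (uIcc 0 h) := by
      refine LipschitzOnWith.of_dist_le_mul fun r _ r' _ => le_of_eq ?_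
      rw [dist_add_left, dist_eq_norm, ← sub_smul, norm_smul, Real.dist_eq, Real.norm_eq_abs,
        mul_comm, coe_nnnorm]
    have hac1 : AbsolutelyContinuousOnInterval (fun r : ℝ => V (y + r • v)) 0 h :=
      hL.comp_absolutelyContinuousOnInterval hlipline.absolutelyContinuousOnInterval
        (by rw [uIcc_of_le h0]; exact hball y hyb)
    have hac2 : AbsolutelyContinuousOnInterval (fun r : ℝ => m * r) 0 h :=
      (contDiff_const.mul contDiff_id : ContDiff ℝ 1 fun r : ℝ => m * r).contDiffOn
        |>.absolutelyContinuousOnInterval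
    have hle := (hac1.sub hac2).le_of_deriv_nonpos h0 (by
      filter_upwards [hy] with r hr hrI w hw
      obtain ⟨hdiff, hder⟩ := hsp _ hr (by simpa using hball y hyb r hrI)
      simp only [LinearMap.toSpanSingleton_apply] at hdiff hder
      have hl : HasDerivAt (fun r : ℝ => y + r • v) v r := by
        simpa using ((hasDerivAt_id r).smul_const v).const_add y
      have h1 : HasDerivAt (fun r : ℝ => V (y + r • v)) (fderiv ℝ V (y + r • v) v) r :=
        hdiff.hasFDerivAt.comp_hasDerivAt r hl
      have h2 : HasDerivAt (fun r : ℝ => m * r) m r := by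
        simpa using (hasDerivAt_id r).const_mul m
      rw [hw.unique (h1.sub h2)]
      linarith)
    simp only [Pi.sub_apply, mul_zero, sub_zero, zero_smul, add_zero] at hle
    linarith
  -- The good base points are dense, so the closed inequality passes to x by continuity of V.
  have hfreq : ∃ᶠ y in 𝓝 x, V (y + h • v) - V y ≤ h * m := by
    have hdense := Measure.dense_of_ae hgood
    refine ((mem_closure_iff_frequently.1 (hdense x)).and_eventually
      (Metric.ball_mem_nhds x (sub_pos.2 hh))).mono fun y hy => hy.1 hy.2
  have hδ : 0 < δ := lt_of_le_of_lt (by positivity) hh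
  have hxv : x + h • v ∈ Metric.ball x δ :=
    hball x (Metric.mem_ball_self (sub_pos.2 hh)) h (right_mem_Icc.2 h0)
  have hc1 : ContinuousAt V (x + h • v) :=
    hL.continuousOn.continuousAt (Metric.isOpen_ball.mem_nhds hxv)
  have hc2 : ContinuousAt V x :=
    hL.continuousOn.continuousAt (Metric.ball_mem_nhds x hδ)
  have hlim : Tendsto (fun y => V (y + h • v) - V y) (𝓝 x) (𝓝 (V (x + h • v) - V x)) := by
    refine Tendsto.sub ?_ hc2
    have : ContinuousAt (fun y : E => y + h • v) x := by fun_prop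
    exact ContinuousAt.comp (f := fun y : E => y + h • v) hc1 this
  exact le_of_tendsto_of_frequently hlim hfreq

/-- The decay condition that holds at almost all points passes to a bound on the upper Dini
derivative at all points at which the strict threshold condition holds. -/
theorem LocallyLipschitz.exists_sub_le_of_ae_fderiv_le {V : E → ℝ} (hV : LocallyLipschitz V)
    {w : E → E} (hw : Continuous w) {G c : ℝ}
    (hd : ∀ᵐ y ∂ν, G ≤ V y → fderiv ℝ V y (w y) ≤ -c * V y) {x : E} (hx : G < V x) {ε : ℝ}
    (hε : 0 < ε) :
    ∃ δ > 0, ∀ h, 0 ≤ h → h < δ → V (x + h • w x) - V x ≤ h * (-c * V x + ε) := by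
  obtain ⟨L, t, ht, hL⟩ := hV x
  have hVc := hV.continuous
  have h1 : ∀ᶠ y in 𝓝 x, -c * V y < -c * V x + ε / 2 :=
    (show ContinuousAt (fun y => -c * V y) x by fun_prop).eventually (gt_mem_nhds (by linarith))
  have h2 : ∀ᶠ y in 𝓝 x, (L : ℝ) * ‖w x - w y‖ < ε / 2 := by
    have : ContinuousAt (fun y => (L : ℝ) * ‖w x - w y‖) x := by fun_prop
    exact this.eventually (gt_mem_nhds (by simpa using by positivity))
  have h3 : ∀ᶠ y in 𝓝 x, G < V y := hVc.continuousAt.eventually (lt_mem_nhds hx)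
  obtain ⟨δ, hδ, hball⟩ := Metric.eventually_nhds_iff_ball.1 (((h1.and h2).and h3).and ht)
  have hLb : LipschitzOnWith L V (Metric.ball x δ) := hL.mono fun y hy => (hball y hy).2
  have hder : ∀ᵐ y ∂ν, y ∈ Metric.ball x δ → fderiv ℝ V y (w x) ≤ -c * V x + ε := by
    filter_upwards [hd] with y hy hyb
    obtain ⟨⟨⟨g1, g2⟩, g3⟩, -⟩ := hball y hyb
    have hnorm : ‖fderiv ℝ V y‖ ≤ L :=
      norm_fderiv_le_of_lipschitzOn ℝ (Metric.isOpen_ball.mem_nhds hyb) hLb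
    -- The hypothesis concerns the direction w(y) at y, but Fubini needs a fixed direction.
    -- Replacing w(y) by w(x) costs at most L ‖w x - w y‖ < ε / 2.
    have hsplit : fderiv ℝ V y (w x) = fderiv ℝ V y (w y) + fderiv ℝ V y (w x - w y) := by
      rw [← map_add]; congr 1; abel
    have hbd : fderiv ℝ V y (w x - w y) ≤ L * ‖w x - w y‖ :=
      (le_abs_self _).trans (((fderiv ℝ V y).le_opNorm _).trans (by gcongr))
    have := hy g3.le
    linarith
  refine ⟨δ / (‖w x‖ + 1), by positivity, fun h h0 hh => hLb.sub_le_of_ae_fderiv_le hder h0 ?_⟩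
  rw [lt_div_iff₀ (by positivity)] at hh
  nlinarith

/-- The derivative of `V` along a curve with velocity `k • w`. -/
theorem LocallyLipschitz.deriv_comp_le_of_ae_fderiv_le {V : E → ℝ} (hV : LocallyLipschitz V)
    {w : E → E} (hw : Continuous w) {G c : ℝ}
    (hd : ∀ᵐ y ∂ν, G ≤ V y → fderiv ℝ V y (w y) ≤ -c * V y) {z : ℝ → E} {t k v' : ℝ}
    (hk : 0 ≤ k) (hz : HasDerivAt z (k • w (z t)) t) (hx : G < V (z t))
    (hv : HasDerivAt (fun t => V (z t)) v' t) : v' ≤ k * (-c * V (z t)) := by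
  -- V need not be differentiable at z(t), so the chain rule is not available. The curve and its
  -- tangent line differ by o(h) and V is Lipschitz near z(t), hence V has the same derivative along
  -- both.
  have hline : HasDerivAt (fun h : ℝ => V (z t + h • k • w (z t))) v' 0 := by
    obtain ⟨L, s, hs, hL⟩ := hV (z t)
    rw [hasDerivAt_iff_isLittleO_nhds_zero] at hz hv ⊢
    have hlim1 : Tendsto (fun h : ℝ => z t + h • k • w (z t)) (𝓝 0) (𝓝 (z t)) := by
      have : Continuous fun h : ℝ => z t + h • k • w (z t) := by fun_prop
      simpa using this.tendsto 0
    have hlim2 : Tendsto (fun h : ℝ => z (t + h)) (𝓝 0) (𝓝 (z t)) := by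
      have hzc : ContinuousAt z t :=
        (hasDerivAt_iff_isLittleO_nhds_zero.2 hz).continuousAt
      refine hzc.tendsto.comp ?_
      have : Continuous fun h : ℝ => t + h := by fun_prop
      simpa using this.tendsto 0
    have hbig : (fun h : ℝ => V (z t + h • k • w (z t)) - V (z (t + h))) =O[𝓝 0]
        fun h : ℝ => z (t + h) - z t - h • k • w (z t) := by
      refine Asymptotics.IsBigO.of_bound L ?_
      filter_upwards [hlim1 hs, hlim2 hs] with h h1 h2
      rw [← dist_eq_norm]
      refine (hL.dist_le_mul _ h1 _ h2).trans (le_of_eq ?_)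
      rw [dist_comm, dist_eq_norm, sub_sub]
    refine ((hbig.trans_isLittleO hz).add hv).congr_left fun h => ?_
    simp only [zero_add, zero_smul, add_zero]
    ring
  refine le_of_forall_pos_le_add fun ε hε => ?_
  -- The direction is k • w, so the bound for w is used with step h k and its error is multiplied by
  -- k; dividing by k + 1 also covers k = 0.
  have hε' : 0 < ε / (k + 1) := by positivity
  obtain ⟨δ, hδ, hle⟩ := hV.exists_sub_le_of_ae_fderiv_le hw hd hx hε'
  have hslope := (hasDerivAt_iff_tendsto_slope_zero.1 hline).mono_left
    (nhdsGT_le_nhdsNE 0)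
  have hbound : k * (-c * V (z t) + ε / (k + 1)) ≤ k * (-c * V (z t)) + ε := by
    have : k * (ε / (k + 1)) ≤ ε := by
      rw [← mul_div_assoc, div_le_iff₀ (by positivity)]
      nlinarith
    linarith
  refine (le_of_tendsto hslope ?_).trans hbound
  have hsmall : ∀ᶠ h : ℝ in 𝓝[>] 0, h < δ / (k + 1) :=
    nhdsWithin_le_nhds (gt_mem_nhds (by positivity))
  filter_upwards [hsmall, self_mem_nhdsWithin] with h hh (h0 : 0 < h)
  rw [lt_div_iff₀ (by positivity)] at hh
  have := hle (h * k) (by positivity) (by nlinarith)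
  rw [smul_eq_mul, inv_mul_le_iff₀ h0]
  simp only [zero_add, zero_smul, add_zero]
  rw [smul_smul]
  linarith

end Clarke

/-! ### Composition and gluing of absolutely continuous functions -/

theorem LocallyLipschitz.comp_absolutelyContinuousOnInterval {X Y : Type*}
    [SeminormedAddCommGroup X] [PseudoMetricSpace Y] {φ : X → Y} {f : ℝ → X} {a b : ℝ} (hφ : LocallyLipschitz φ)
    (hf : AbsolutelyContinuousOnInterval f a b) :
    AbsolutelyContinuousOnInterval (fun t => φ (f t)) a b := by
  obtain ⟨K, hK⟩ := (hφ.locallyLipschitzOn (s := f '' uIcc a b)).exists_lipschitzOnWith_of_compact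
    (isCompact_uIcc.image_of_continuousOn hf.continuousOn)
  exact hK.comp_absolutelyContinuousOnInterval hf (mapsTo_image _ _)

/-- Meant for the truncations `min · b` and `max · b`: they map disjoint intervals to disjoint
intervals without increasing the total length, so the same δ works. -/
theorem AbsolutelyContinuousOnInterval.comp_of_uIoc_subset {X : Type*} [PseudoMetricSpace X]
    {f : ℝ → X} {φ : ℝ → ℝ} {a b c d : ℝ} (hf : AbsolutelyContinuousOnInterval f c d)
    (hmaps : MapsTo φ (uIcc a b) (uIcc c d)) (hdist : ∀ s t, dist (φ s) (φ t) ≤ dist s t)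
    (hsub : ∀ s t, uIoc (φ s) (φ t) ⊆ uIoc s t) :
    AbsolutelyContinuousOnInterval (fun t => f (φ t)) a b := by
  rw [absolutelyContinuousOnInterval_iff] at hf ⊢
  intro ε hε
  obtain ⟨δ, hδ, h⟩ := hf ε hε
  refine ⟨δ, hδ, fun E hE hE' => h (E.1, fun i => (φ (E.2 i).1, φ (E.2 i).2)) ⟨?_, ?_⟩ ?_⟩
  · exact fun i hi => ⟨hmaps (hE.1 i hi).1, hmaps (hE.1 i hi).2⟩
  · exact fun i hi j hj hij => (hE.2 hi hj hij).mono (hsub _ _) (hsub _ _)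
  · exact lt_of_le_of_lt (Finset.sum_le_sum fun i _ => hdist _ _) hE'

/-- Two absolutely continuous functions on adjacent intervals can be glued. -/
theorem AbsolutelyContinuousOnInterval.glue {F : Type*} [NormedAddCommGroup F] [NormedSpace ℝ F]
    {f g h : ℝ → F} {a b c : ℝ}
    (hab : a ≤ b) (hbc : b ≤ c) (hf : AbsolutelyContinuousOnInterval f a b)
    (hg : AbsolutelyContinuousOnInterval g b c) (hfh : EqOn f h (Icc a b))
    (hgh : EqOn g h (Icc b c)) : AbsolutelyContinuousOnInterval h a c := by
  have h1 : AbsolutelyContinuousOnInterval (fun t => f (min t b)) a c := by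
    refine hf.comp_of_uIoc_subset ?_ ?_ ?_
    · rw [uIcc_of_le hab, uIcc_of_le (hab.trans hbc)]
      exact fun t ht => ⟨le_min ht.1 hab, min_le_right _ _⟩
    · intro s t
      simp only [Real.dist_eq]
      simpa using abs_min_sub_min_le_max s b t b
    · intro s t r hr
      simp only [mem_uIoc] at hr ⊢
      grind
  have h2 : AbsolutelyContinuousOnInterval (fun t => g (max t b)) a c := by
    refine hg.comp_of_uIoc_subset ?_ ?_ ?_
    · rw [uIcc_of_le hbc, uIcc_of_le (hab.trans hbc)]
      exact fun t ht => ⟨le_max_right _ _, max_le ht.2 hbc⟩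
    · intro s t
      simp only [Real.dist_eq]
      simpa using abs_max_sub_max_le_max s b t b
    · intro s t r hr
      simp only [mem_uIoc] at hr ⊢
      grind
  have h3 : AbsolutelyContinuousOnInterval (fun _ : ℝ => h b) a c :=
    (LipschitzWith.const (h b)).lipschitzOnWith.absolutelyContinuousOnInterval
  -- On [a,c], h(t) = f(min t b) + g(max t b) - h(b).
  refine ((h1.add h2).sub h3).congr fun t ht => ?_
  rw [uIcc_of_le (hab.trans hbc)] at ht
  simp only [Pi.sub_apply, Pi.add_apply]
  rcases le_total t b with htb | htb
  · rw [min_eq_left htb, max_eq_right htb, hfh ⟨ht.1, htb⟩, hgh (left_mem_Icc.2 hbc)]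
    abel
  · rw [min_eq_right htb, max_eq_left htb, hgh ⟨htb, ht.2⟩, hfh (right_mem_Icc.2 hab)]
    abel

/-! ### Flows of control systems -/

section ControlSystem

variable {E U : Type*} [NormedAddCommGroup E] [InnerProductSpace ℝ E] [FiniteDimensional ℝ E]
  [NormedAddCommGroup U] [NormedSpace ℝ U] [FiniteDimensional ℝ U]
  {f : E → U → E} {u : ℝ → U} {a b C : ℝ}

/-- Uniqueness of Carathéodory solutions for a locally Lipschitz right-hand side and a bounded
input. -/
theorem eqOn_of_caratheodory_solutions
    (hf : LocallyLipschitz fun z : E × U => f z.1 z.2) (hu : ∀ s ∈ Icc a b, ‖u s‖ ≤ C)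
    {y z : ℝ → E} (hy : AbsolutelyContinuousOnInterval y a b)
    (hz : AbsolutelyContinuousOnInterval z a b)
    (hyd : ∀ᵐ t, t ∈ Icc a b → HasDerivAt y (f (y t) (u t)) t)
    (hzd : ∀ᵐ t, t ∈ Icc a b → HasDerivAt z (f (z t) (u t)) t) (h0 : y a = z a) :
    EqOn y z (Icc a b) := by
  intro t ht
  obtain ⟨Cy, hCy⟩ := hy.exists_bound
  obtain ⟨Cz, hCz⟩ := hz.exists_bound
  obtain ⟨K, hK⟩ := (hf.locallyLipschitzOn (s := Metric.closedBall (0 : E) (max Cy Cz) ×ˢ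
    Metric.closedBall (0 : U) C)).exists_lipschitzOnWith_of_compact
    ((isCompact_closedBall _ _).prod (isCompact_closedBall _ _))
  have hsub : uIcc a t ⊆ uIcc a b := by
    rw [uIcc_of_le ht.1, uIcc_of_le (ht.1.trans ht.2)]
    exact Icc_subset_Icc_right ht.2
  have hsq : LocallyLipschitz fun e : E => ‖e‖ ^ 2 := (contDiff_norm_sq ℝ).locallyLipschitz
  have hyz : AbsolutelyContinuousOnInterval (y - z) a t := (hy.sub hz).mono hsub
  have hac : AbsolutelyContinuousOnInterval (fun t => ‖(y - z) t‖ ^ 2) a t :=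
    hsq.comp_absolutelyContinuousOnInterval hyz
  -- Grönwall for ‖y - z‖², whose derivative is 2⟨y - z, f(y,u) - f(z,u)⟩ ≤ 2K ‖y - z‖², with K a
  -- Lipschitz constant on a compact set that contains both trajectories and the input.
  have hle := hac.le_exp_mul (K := 2 * K) ht.1 (by
    filter_upwards [hyd, hzd] with s hys hzs hs w hw
    have hs' : s ∈ Icc a b := ⟨hs.1, hs.2.trans ht.2⟩
    rw [hw.unique (((hys hs').sub (hzs hs')).norm_sq)]
    have hsu : s ∈ uIcc a b := by rwa [uIcc_of_le (ht.1.trans ht.2)]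
    have hm1 : (y s, u s) ∈ Metric.closedBall (0 : E) (max Cy Cz) ×ˢ
        Metric.closedBall (0 : U) C :=
      ⟨by simpa using Or.inl (hCy s hsu), by simpa using hu s hs'⟩
    have hm2 : (z s, u s) ∈ Metric.closedBall (0 : E) (max Cy Cz) ×ˢ
        Metric.closedBall (0 : U) C :=
      ⟨by simpa using Or.inr (hCz s hsu), by simpa using hu s hs'⟩
    have hd := hK.dist_le_mul _ hm1 _ hm2
    rw [Prod.dist_eq, dist_self, max_eq_left dist_nonneg] at hd
    simp only [dist_eq_norm] at hd
    have hin := real_inner_le_norm (y s - z s) (f (y s) (u s) - f (z s) (u s))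
    simp only [Pi.sub_apply]
    nlinarith [norm_nonneg (y s - z s)])
  simp only [Pi.sub_apply, h0, sub_self, norm_zero] at hle
  have : ‖y t - z t‖ = 0 := by
    have h2 : ‖y t - z t‖ ^ 2 ≤ 0 := by simpa using hle
    exact pow_eq_zero_iff (two_ne_zero) |>.1 (le_antisymm h2 (by positivity))
  exact sub_eq_zero.1 (norm_eq_zero.1 this)

variable [MeasurableSpace E] [BorelSpace E] [MeasurableSpace U] [BorelSpace U]

/-- Existence of Carathéodory solutions of the system with the right-hand side multiplied by a
cutoff function that is equal to one on the ball of radius `R`. -/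
theorem exists_cutoff_solution (hab : a ≤ b)
    (hf : LocallyLipschitz fun z : E × U => f z.1 z.2) (hu : ∀ s ∈ Icc a b, ‖u s‖ ≤ C)
    (hum : AEMeasurable u (volume.restrict (Icc a b))) (R : ℝ) (xa : E) :
    ∃ (z : ℝ → E) (ψ : E → ℝ), z a = xa ∧ AbsolutelyContinuousOnInterval z a b ∧
      (∀ x, ψ x ∈ Icc 0 1) ∧ (∀ x, ‖x‖ ≤ R → ψ x = 1) ∧
      ∀ᵐ t, t ∈ Icc a b → HasDerivAt z (ψ (z t) • f (z t) (u t)) t := by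
  set ψ : E → ℝ := fun x => max 0 (min 1 (R + 1 - ‖x‖)) with hψ
  have hψ01 : ∀ x, ψ x ∈ Icc 0 1 := fun x => ⟨le_max_left _ _, max_le zero_le_one (min_le_left _ _)⟩
  have hψ0 : ∀ x, R + 1 < ‖x‖ → ψ x = 0 := fun x hx =>
    max_eq_left ((min_le_right _ _).trans (by linarith))
  have hψlip : ∀ x y, |ψ x - ψ y| ≤ ‖x - y‖ := by
    intro x y
    have h1 : |ψ x - ψ y| ≤ |min 1 (R + 1 - ‖x‖) - min 1 (R + 1 - ‖y‖)| := by
      simpa using abs_max_sub_max_le_max 0 (min 1 (R + 1 - ‖x‖)) 0 (min 1 (R + 1 - ‖y‖))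
    have h2 : |min 1 (R + 1 - ‖x‖) - min 1 (R + 1 - ‖y‖)| ≤ |‖y‖ - ‖x‖| := by
      simpa using abs_min_sub_min_le_max 1 (R + 1 - ‖x‖) 1 (R + 1 - ‖y‖)
    exact h1.trans (h2.trans ((abs_norm_sub_norm_le _ _).trans_eq (norm_sub_rev _ _)))
  have hψc : Continuous ψ := by fun_prop
  have hcomp : IsCompact (Metric.closedBall (0 : E) (R + 1) ×ˢ Metric.closedBall (0 : U) C) :=
    (isCompact_closedBall _ _).prod (isCompact_closedBall _ _)
  obtain ⟨K, hK⟩ := (hf.locallyLipschitzOn).exists_lipschitzOnWith_of_compact hcomp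
  obtain ⟨B, hB⟩ := hcomp.exists_bound_of_continuousOn hf.continuous.continuousOn
  have hB' : ∀ s ∈ Icc a b, ∀ x, ‖x‖ ≤ R + 1 → ‖f x (u s)‖ ≤ max B 0 := fun s hs x hx =>
    (hB (x, u s) ⟨by simpa using hx, by simpa using hu s hs⟩).trans (le_max_left _ _)
  have hB0 : 0 ≤ max B 0 := le_max_right _ _
  have hbound : ∀ s ∈ Icc a b, ∀ x, ‖ψ x • f x (u s)‖ ≤ max B 0 := by
    intro s hs x
    rcases le_or_gt ‖x‖ (R + 1) with hx | hx
    · rw [norm_smul, Real.norm_of_nonneg (hψ01 x).1]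
      exact (mul_le_of_le_one_left (norm_nonneg _) (hψ01 x).2).trans (hB' s hs x hx)
    · simp [hψ0 x hx]
  have hlip1 : ∀ s ∈ Icc a b, ∀ x y, ‖x‖ ≤ R + 1 →
      dist (ψ x • f x (u s)) (ψ y • f y (u s)) ≤ (K + max B 0) * dist x y := by
    intro s hs x y hx
    -- With x in the ball of radius R + 1, f(x,u) is bounded in the first term. In the second term
    -- either y is in the ball too, or ψ(y) = 0.
    have hsplit : ψ x • f x (u s) - ψ y • f y (u s) =
        (ψ x - ψ y) • f x (u s) + ψ y • (f x (u s) - f y (u s)) := by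
      rw [sub_smul, smul_sub]; abel
    have h1 : ‖(ψ x - ψ y) • f x (u s)‖ ≤ ‖x - y‖ * max B 0 := by
      rw [norm_smul, Real.norm_eq_abs]
      exact mul_le_mul (hψlip x y) (hB' s hs x hx) (norm_nonneg _) (norm_nonneg _)
    have h2 : ‖ψ y • (f x (u s) - f y (u s))‖ ≤ K * ‖x - y‖ := by
      rcases le_or_gt ‖y‖ (R + 1) with hy | hy
      · rw [norm_smul, Real.norm_of_nonneg (hψ01 y).1]
        refine (mul_le_of_le_one_left (norm_nonneg _) (hψ01 y).2).trans ?_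
        have := hK.dist_le_mul (x, u s) ⟨by simpa using hx, by simpa using hu s hs⟩ (y, u s)
          ⟨by simpa using hy, by simpa using hu s hs⟩
        rw [Prod.dist_eq, dist_self, max_eq_left dist_nonneg] at this
        simpa only [dist_eq_norm] using this
      · rw [hψ0 y hy, zero_smul, norm_zero]
        positivity
    rw [dist_eq_norm, dist_eq_norm, hsplit]
    exact (norm_add_le _ _).trans (by linarith)
  have hlip : ∀ s ∈ Icc a b, LipschitzWith (K + (max B 0).toNNReal) fun x => ψ x • f x (u s) := by
    intro s hs
    refine LipschitzWith.of_dist_le_mul fun x y => ?_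
    rw [NNReal.coe_add, Real.coe_toNNReal _ hB0]
    rcases le_or_gt ‖x‖ (R + 1) with hx | hx
    · exact hlip1 s hs x y hx
    rcases le_or_gt ‖y‖ (R + 1) with hy | hy
    · rw [dist_comm, dist_comm x y]
      exact hlip1 s hs y x hy
    · rw [hψ0 x hx, hψ0 y hy, zero_smul, zero_smul, dist_self]
      positivity
  have hmeas : ∀ z : ℝ → E, Continuous z → AEStronglyMeasurable
      (fun s => ψ (z s) • f (z s) (u s)) (volume.restrict (Icc a b)) := by
    intro z hz
    have h1 : AEMeasurable (fun s => f (z s) (u s)) (volume.restrict (Icc a b)) :=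
      hf.continuous.measurable.comp_aemeasurable (hz.aemeasurable.prodMk hum)
    exact (hψc.comp hz).aestronglyMeasurable.smul h1.aestronglyMeasurable
  obtain ⟨z, hz0, hzac, hzd⟩ := exists_caratheodory_solution
    (F := fun s x => ψ x • f x (u s)) hab hlip hbound hmeas xa
  refine ⟨z, ψ, hz0, hzac, hψ01, fun x hx => ?_, hzd⟩
  rw [hψ]
  simp only
  rw [min_eq_left (by linarith), max_eq_right zero_le_one]

/-- The solutions of a control system with a Lyapunov function that grows at most exponentially
where it exceeds the threshold do not blow up. -/
theorem exists_solution_of_lyapunov (hab : a ≤ b)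
    (hf : LocallyLipschitz fun z : E × U => f z.1 z.2) (hu : ∀ s ∈ Icc a b, ‖u s‖ ≤ C)
    (hum : AEMeasurable u (volume.restrict (Icc a b)))
    {ν : Measure E} [ν.IsAddHaarMeasure] {V : E → ℝ} (hV : LocallyLipschitz V)
    (hVnn : ∀ x, 0 ≤ V x) (hVbdd : ∀ B, ∃ R, ∀ x, V x ≤ B → ‖x‖ ≤ R) {G : U → ℝ} {c ρ : ℝ}
    (hd : ∀ᵐ y ∂ν, ∀ v, G v ≤ V y → fderiv ℝ V y (f y v) ≤ -c * V y)
    (hρ : ∀ s ∈ Icc a b, G (u s) ≤ ρ) (xa : E) :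
    ∃ z : ℝ → E, z a = xa ∧ AbsolutelyContinuousOnInterval z a b ∧
      (∀ᵐ t, t ∈ Icc a b → HasDerivAt z (f (z t) (u t)) t) ∧
      (V (z b) ≤ Real.exp (-c * (b - a)) * V xa ∨
        ∃ τ ∈ Icc a b, V (z b) ≤ Real.exp (-c * (b - τ)) * ρ) := by
  -- This a priori bound of V does not involve the cutoff, so the radius R can be chosen from it
  -- before the cutoff is made.
  set B : ℝ := Real.exp (|c| * (b - a)) * max (V xa) ρ with hB
  obtain ⟨R, hR⟩ := hVbdd B
  obtain ⟨z, ψ, hz0, hzac, hψ, hψ1, hzd⟩ := exists_cutoff_solution hab hf hu hum R xa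
  have hfc : ∀ v, Continuous fun x => f x v := fun v =>
    hf.continuous.comp (continuous_id.prodMk continuous_const)
  have hvac : AbsolutelyContinuousOnInterval (fun t => V (z t)) a b :=
    hV.comp_absolutelyContinuousOnInterval hzac
  have hvd : ∀ᵐ t, t ∈ Icc a b → ρ < V (z t) → ∀ v', HasDerivAt (fun t => V (z t)) v' t →
      v' ≤ ψ (z t) * (-c * V (z t)) := by
    filter_upwards [hzd] with t ht htm hlt v' hv'
    exact hV.deriv_comp_le_of_ae_fderiv_le (hfc (u t)) (ν := ν) (hd.mono fun y hy => hy (u t))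
      (hψ _).1 (ht htm) ((hρ t htm).trans_lt hlt) hv'
  have hbound : ∀ t ∈ Icc a b, ‖z t‖ ≤ R := by
    intro t ht
    refine hR _ ?_
    have hm0 : 0 ≤ max (V xa) ρ := (hVnn xa).trans (le_max_left _ _)
    have hexp : ∀ s ∈ Icc a t, ∀ q, q ≤ max (V xa) ρ →
        Real.exp (|c| * (t - s)) * q ≤ B := by
      intro s hs q hq
      refine (mul_le_mul_of_nonneg_left hq (Real.exp_pos _).le).trans
        (mul_le_mul_of_nonneg_right ?_ hm0)
      gcongr
      · exact ht.2
      · exact hs.1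
    have hsub : uIcc a t ⊆ uIcc a b := by
      rw [uIcc_of_le ht.1, uIcc_of_le hab]
      exact Icc_subset_Icc_right ht.2
    -- The cut-off flow only gives V' ≤ -c ψ V with ψ in [0,1], which is at most |c| V for either
    -- sign of c. The sharp rate -c is recovered once ψ = 1 along the trajectory.
    rcases (hvac.mono hsub).le_exp_mul_or_exists (K := |c|) (ρ := ρ) ht.1 (by
      filter_upwards [hvd] with s hs hsm hlt v' hv'
      refine (hs ⟨hsm.1, hsm.2.trans ht.2⟩ hlt v' hv').trans ?_
      have h1 : -c * V (z s) ≤ |c| * V (z s) :=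
        mul_le_mul_of_nonneg_right (neg_le_abs c) (hVnn _)
      have h2 : 0 ≤ |c| * V (z s) := mul_nonneg (abs_nonneg _) (hVnn _)
      have := hψ (z s)
      nlinarith [this.1, this.2]) with h | ⟨τ, hτ, h⟩
    · rw [hz0] at h
      exact h.trans (hexp a (left_mem_Icc.2 ht.1) _ (le_max_left _ _))
    · exact h.trans (hexp τ hτ _ (le_max_right _ _))
  refine ⟨z, hz0, hzac, ?_, ?_⟩
  · filter_upwards [hzd] with t ht htm
    have := ht htm
    rwa [hψ1 _ (hbound t htm), one_smul] at this
  · rw [← hz0]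
    refine hvac.le_exp_mul_or_exists hab ?_
    filter_upwards [hvd] with t ht htm hlt v' hv'
    have := ht htm hlt v' hv'
    rwa [hψ1 _ (hbound t htm), one_mul] at this

end ControlSystem

namespace ImpulsiveISS

variable {N M p : ℕ} {S : System N M p} {t₀ : ℝ} {T : Fin p → Set ℝ}
  {u : ℝ → EuclideanSpace ℝ (Fin M)} {x y : ℝ → EuclideanSpace ℝ (Fin N)}

/-! ### Impulse times -/

theorem IsImpulseTimes.finite_iUnion (hT : IsImpulseTimes t₀ T) (t : ℝ) :
    ((⋃ i, T i) ∩ Ioc t₀ t).Finite := by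
  rw [iUnion_inter]
  exact Set.finite_iUnion fun i => hT.finite i t

/-- Induction along intervals without impulses in their interior. -/
theorem IsImpulseTimes.induction (hT : IsImpulseTimes t₀ T) {P : ℝ → Prop} {H : ℝ} (h0 : P t₀)
    (hstep : ∀ a b, t₀ ≤ a → a < b → b ≤ H → (∀ i, Disjoint (T i) (Ioo a b)) → P a → P b) :
    ∀ b, t₀ ≤ b → b ≤ H → P b := by
  have hfin : ∀ b, ((⋃ i, T i) ∩ Ioo t₀ b).Finite := fun b =>
    (hT.finite_iUnion b).subset (inter_subset_inter_right _ Ioo_subset_Ioc_self)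
  -- Strong induction on the number of impulses in (t₀,b), which is finite; the step goes back to
  -- the last impulse before b.
  suffices h : ∀ n : ℕ, ∀ b, t₀ ≤ b → b ≤ H → ((⋃ i, T i) ∩ Ioo t₀ b).ncard = n → P b from
    fun b hb hbH => h _ b hb hbH rfl
  intro n
  induction n using Nat.strong_induction_on with
  | _ n ih =>
    intro b hb hbH hn
    rcases eq_or_lt_of_le hb with rfl | hlt
    · exact h0
    rcases ((⋃ i, T i) ∩ Ioo t₀ b).eq_empty_or_nonempty with he | hne
    · refine hstep t₀ b le_rfl hlt hbH (fun i => ?_) h0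
      rw [disjoint_iff_inter_eq_empty, ← subset_empty_iff, ← he]
      exact inter_subset_inter_left _ (subset_iUnion T i)
    · obtain ⟨a, ⟨haT, ha⟩, hmax⟩ := (hfin b).exists_maximal hne
      refine hstep a b ha.1.le ha.2 hbH (fun i => ?_) (ih _ ?_ a ha.1.le (ha.2.le.trans hbH) rfl)
      · rw [Set.disjoint_left]
        intro t ht hab
        exact hab.1.not_ge (hmax ⟨mem_iUnion.2 ⟨i, ht⟩, ha.1.trans hab.1, hab.2⟩ hab.1.le)
      · rw [← hn]
        refine ncard_lt_ncard ⟨?_, fun hsub => ?_⟩ (hfin b)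
        · exact inter_subset_inter_right _ (Ioo_subset_Ioo_right ha.2.le)
        · exact lt_irrefl a (hsub ⟨haT, ha⟩).2.2

theorem IsImpulseTimes.lt_of_mem (hT : IsImpulseTimes t₀ T) {i : Fin p} {t : ℝ} (ht : t ∈ T i) :
    t₀ < t := hT.subset i ht

theorem IsImpulseTimes.eq_of_mem (hT : IsImpulseTimes t₀ T) {i j : Fin p} {t : ℝ} (hi : t ∈ T i)
    (hj : t ∈ T j) : i = j := by
  by_contra hij
  exact Set.disjoint_left.1 (hT.disjoint i j hij) hi hj

/-! ### Solutions -/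

theorem System.IsSolutionOn.mono {J J' : Set ℝ} (hx : S.IsSolutionOn T u x J) (h : J' ⊆ J) :
    S.IsSolutionOn T u x J' where
  ac a ha b hb := hx.ac a (h ha) b (h hb)
  flow := hx.flow.mono fun _ ht htJ => ht (h htJ)
  jump i t ht htJ := hx.jump i t ht (h htJ)

theorem System.IsSolutionOn.congr {b : ℝ} (hx : S.IsSolutionOn T u x (Icc t₀ b))
    (hT : IsImpulseTimes t₀ T) (h : EqOn x y (Icc t₀ b)) :
    S.IsSolutionOn T u y (Icc t₀ b) where
  ac s hs t ht hst hd := (hx.ac s hs t ht hst hd).congr (h.mono (by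
    rw [uIcc_of_le hst]; exact Icc_subset_Icc hs.1 ht.2))
  flow := by
    -- Derivatives are two-sided, while the functions agree on [t₀,b] only, so the endpoints are
    -- discarded.
    have h1 : ∀ᵐ t : ℝ, t ≠ t₀ := by simp [ae_iff, measure_singleton]
    have h2 : ∀ᵐ t : ℝ, t ≠ b := by simp [ae_iff, measure_singleton]
    filter_upwards [hx.flow, h1, h2] with t ht ht0 htb htm htT
    have hd := ht htm htT
    rw [← h htm]
    refine hd.congr_of_eventuallyEq ?_
    filter_upwards [Ioo_mem_nhds (lt_of_le_of_ne htm.1 ht0.symm) (lt_of_le_of_ne htm.2 htb)]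
      with s hs
    exact (h (Ioo_subset_Icc_self hs)).symm
  jump i t ht htJ := by
    obtain ⟨xm, um, hxm, hum, hg⟩ := hx.jump i t ht htJ
    refine ⟨xm, um, hxm.congr' ?_, hum, by rw [← h htJ, hg]⟩
    filter_upwards [Ioo_mem_nhdsLT (hT.lt_of_mem ht)] with s hs
    exact h ⟨hs.1.le, hs.2.le.trans htJ.2⟩

theorem System.isSolutionOn_Ici (h : ∀ b, t₀ ≤ b → S.IsSolutionOn T u x (Icc t₀ b)) :
    S.IsSolutionOn T u x (Ici t₀) where
  ac s hs t ht hst hd := (h t ht).ac s ⟨hs, hst⟩ t ⟨ht, le_rfl⟩ hst hd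
  flow := by
    have : ∀ᵐ t : ℝ, ∀ n : ℕ, t ∈ Icc t₀ (t₀ + n) → (∀ i, t ∉ T i) →
        HasDerivAt x (S.f (x t) (u t)) t :=
      ae_all_iff.2 fun n => (h (t₀ + n) (by simp)).flow
    filter_upwards [this] with t ht htJ htT
    obtain ⟨n, hn⟩ := exists_nat_ge (t - t₀)
    exact ht n ⟨htJ, by linarith⟩ htT
  jump i t ht htJ := (h t htJ).jump i t ht ⟨htJ, le_rfl⟩

theorem IsInput.aemeasurable_restrict (hu : IsInput t₀ T u) {a b : ℝ} (ha : t₀ ≤ a) :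
    AEMeasurable u (volume.restrict (Icc a b)) :=
  hu.measurable.mono_measure (Measure.restrict_mono (fun _ ht => ha.trans ht.1) le_rfl)

theorem disjoint_Ioc_of_disjoint_Ioo {a b t : ℝ} (h : ∀ i, Disjoint (T i) (Ioo a b))
    (ht : t < b ∨ t = b ∧ ∀ i, b ∉ T i) (i : Fin p) : Disjoint (T i) (Ioc a t) := by
  rw [Set.disjoint_left]
  intro s hs hst
  rcases ht with ht | ⟨rfl, ht⟩
  · exact Set.disjoint_left.1 (h i) hs ⟨hst.1, hst.2.trans_lt ht⟩
  · rcases eq_or_lt_of_le hst.2 with rfl | hlt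
    · exact ht i hs
    · exact Set.disjoint_left.1 (h i) hs ⟨hst.1, hlt⟩

/-- On an interval without impulses, a solution satisfies the differential equation almost
everywhere. -/
theorem System.IsSolutionOn.ae_hasDerivAt {J : Set ℝ} (hx : S.IsSolutionOn T u x J) {a t : ℝ}
    (hJ : Icc a t ⊆ J) (hd : ∀ i, Disjoint (T i) (Ioc a t)) :
    ∀ᵐ s, s ∈ Icc a t → HasDerivAt x (S.f (x s) (u s)) s := by
  have h1 : ∀ᵐ s : ℝ, s ≠ a := by simp [ae_iff, measure_singleton]
  filter_upwards [hx.flow, h1] with s hs hsa hsm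
  exact hs (hJ hsm) fun i hi =>
    Set.disjoint_left.1 (hd i) hi ⟨lt_of_le_of_ne hsm.1 hsa.symm, hsm.2⟩

/-- Uniqueness of the solutions of an impulsive system. -/
theorem System.IsSolutionOn.eqOn {H : ℝ} (hT : IsImpulseTimes t₀ T) (hu : IsInput t₀ T u)
    (hx : S.IsSolutionOn T u x (Icc t₀ H)) (hy : S.IsSolutionOn T u y (Icc t₀ H))
    (h0 : x t₀ = y t₀) : EqOn x y (Icc t₀ H) := by
  suffices h : ∀ b, t₀ ≤ b → b ≤ H → EqOn x y (Icc t₀ b) from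
    fun t ht => h t ht.1 ht.2 ⟨ht.1, le_rfl⟩
  refine hT.induction (by intro t ht; simp only [Icc_self, mem_singleton_iff] at ht; rw [ht, h0]) ?_
  intro a b ha hab hbH hd heq
  obtain ⟨C, hC⟩ := hu.bounded b
  have hflow : ∀ t, a ≤ t → (t < b ∨ t = b ∧ ∀ i, b ∉ T i) → EqOn x y (Icc a t) := by
    intro t hat ht
    have hd' := disjoint_Ioc_of_disjoint_Ioo hd ht
    have htb : t ≤ b := ht.elim le_of_lt fun h => h.1.le
    have hJ : Icc a t ⊆ Icc t₀ H := Icc_subset_Icc ha (htb.trans hbH)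
    have haJ := hJ (left_mem_Icc.2 hat)
    have htJ := hJ (right_mem_Icc.2 hat)
    exact eqOn_of_caratheodory_solutions S.locallyLipschitz_f
      (fun s hs => hC s ⟨ha.trans hs.1, hs.2.trans htb⟩)
      (hx.ac a haJ t htJ hat hd') (hy.ac a haJ t htJ hat hd')
      (hx.ae_hasDerivAt hJ hd') (hy.ae_hasDerivAt hJ hd') (heq ⟨ha, le_rfl⟩)
  have hlt : ∀ t, t₀ ≤ t → t < b → x t = y t := by
    intro t ht0 htb
    rcases le_total t a with hta | hat
    · exact heq ⟨ht0, hta⟩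
    · exact hflow t hat (Or.inl htb) ⟨hat, le_rfl⟩
  -- At an impulse both solutions jump from the same left limits; otherwise uniqueness of the flow
  -- reaches b.
  have hb : x b = y b := by
    by_cases hbT : ∃ i, b ∈ T i
    · obtain ⟨i, hi⟩ := hbT
      have hbJ : b ∈ Icc t₀ H := ⟨ha.trans hab.le, hbH⟩
      obtain ⟨xm, um, hxm, hum, hgx⟩ := hx.jump i b hi hbJ
      obtain ⟨ym, vm, hym, hvm, hgy⟩ := hy.jump i b hi hbJ
      have h1 : Tendsto y (𝓝[<] b) (𝓝 xm) := hxm.congr' (by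
        filter_upwards [Ioo_mem_nhdsLT hab] with t ht
        exact hlt t (ha.trans ht.1.le) ht.2)
      rw [hgx, hgy, tendsto_nhds_unique h1 hym, tendsto_nhds_unique hum hvm]
    · push Not at hbT
      exact hflow b hab.le (Or.inr ⟨rfl, hbT⟩) ⟨hab.le, le_rfl⟩
  intro t ht
  rcases eq_or_lt_of_le ht.2 with rfl | h
  · exact hb
  · exact hlt t ht.1 h

/-- Extension of a solution by a flow on `[a,b]` and a possible jump at `b`. -/
theorem System.IsSolutionOn.extend {a b : ℝ} (ha : t₀ ≤ a)
    (hab : a < b) (hd : ∀ i, Disjoint (T i) (Ioo a b)) (hx : S.IsSolutionOn T u x (Icc t₀ a))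
    {z : ℝ → EuclideanSpace ℝ (Fin N)} (hza : z a = x a)
    (hzac : AbsolutelyContinuousOnInterval z a b)
    (hzd : ∀ᵐ t, t ∈ Icc a b → HasDerivAt z (S.f (z t) (u t)) t)
    {xb : EuclideanSpace ℝ (Fin N)} (hflow : (∀ i, b ∉ T i) → xb = z b)
    (hjump : ∀ i, b ∈ T i → ∃ um, Tendsto u (𝓝[<] b) (𝓝 um) ∧ xb = S.g i (z b) um) :
    ∃ w, EqOn w x (Icc t₀ a) ∧ w b = xb ∧ S.IsSolutionOn T u w (Icc t₀ b) := by
  set w : ℝ → EuclideanSpace ℝ (Fin N) :=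
    fun t => if t ≤ a then x t else if t < b then z t else xb with hw
  have hwx : ∀ t, t ≤ a → w t = x t := fun t ht => if_pos ht
  have hwz : ∀ t, a ≤ t → t < b → w t = z t := by
    intro t hat htb
    rcases eq_or_lt_of_le hat with rfl | h
    · rw [hwx _ le_rfl, hza]
    · rw [hw]; simp only; rw [if_neg h.not_ge, if_pos htb]
  have hwb : w b = xb := by
    rw [hw]; simp only; rw [if_neg hab.not_ge, if_neg (lt_irrefl b)]
  -- If t = b, absence of impulses in (s,t] forces that b is not an impulse, so the value at b is
  -- z(b) and there is no jump to account for.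
  have hwzI : ∀ s t, a ≤ s → s ≤ t → t ≤ b → (∀ i, Disjoint (T i) (Ioc s t)) → s < t →
      EqOn z w (Icc s t) := by
    intro s t has hst htb hdis hlt r hr
    rcases eq_or_lt_of_le (hr.2.trans htb) with rfl | h
    · have htr : t = r := le_antisymm htb hr.2
      subst htr
      rw [hwb, hflow fun i hi => Set.disjoint_left.1 (hdis i) hi ⟨hlt, le_rfl⟩]
    · exact (hwz r (has.trans hr.1) h).symm
  have hsubz : ∀ s t, a ≤ s → s ≤ t → t ≤ b → AbsolutelyContinuousOnInterval z s t := by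
    intro s t has hst htb
    refine hzac.mono ?_
    rw [uIcc_of_le hst, uIcc_of_le hab.le]
    exact Icc_subset_Icc has htb
  refine ⟨w, fun t ht => hwx t ht.2, hwb, ⟨?_, ?_, ?_⟩⟩
  · intro s hs t ht hst hdis
    rcases eq_or_lt_of_le hst with rfl | hlt
    · refine LipschitzOnWith.absolutelyContinuousOnInterval (K := 0) ?_
      rw [uIcc_self]
      refine LipschitzOnWith.of_dist_le_mul fun r hr r' hr' => ?_
      rw [mem_singleton_iff.1 hr, mem_singleton_iff.1 hr']
      simp
    rcases le_or_gt t a with hta | hat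
    · refine (hx.ac s ⟨hs.1, hst.trans hta⟩ t ⟨ht.1, hta⟩ hst hdis).congr fun r hr => ?_
      rw [uIcc_of_le hst] at hr
      exact (hwx r (hr.2.trans hta)).symm
    rcases le_or_gt a s with has | hsa
    · refine (hsubz s t has hst ht.2).congr ?_
      rw [uIcc_of_le hst]
      exact hwzI s t has hst ht.2 hdis hlt
    · refine AbsolutelyContinuousOnInterval.glue hsa.le hat.le
        (hx.ac s ⟨hs.1, hsa.le⟩ a ⟨ha, le_rfl⟩ hsa.le fun i =>
          (hdis i).mono_right (Ioc_subset_Ioc_right hat.le))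
        (hsubz a t le_rfl hat.le ht.2) (fun r hr => (hwx r hr.2).symm)
        (hwzI a t le_rfl hat.le ht.2 (fun i =>
          (hdis i).mono_right (Ioc_subset_Ioc_left hsa.le)) hat)
  · have h1 : ∀ᵐ t : ℝ, t ≠ a := by simp [ae_iff, measure_singleton]
    have h2 : ∀ᵐ t : ℝ, t ≠ b := by simp [ae_iff, measure_singleton]
    filter_upwards [hx.flow, hzd, h1, h2] with t htx htz hta htb htm htT
    rcases lt_or_gt_of_ne hta with h | h
    · rw [hwx t h.le]
      refine (htx ⟨htm.1, h.le⟩ htT).congr_of_eventuallyEq ?_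
      filter_upwards [gt_mem_nhds h] with s hs
      exact hwx s hs.le
    · have hlt := lt_of_le_of_ne htm.2 htb
      rw [hwz t h.le hlt]
      refine (htz ⟨h.le, htm.2⟩).congr_of_eventuallyEq ?_
      filter_upwards [Ioo_mem_nhds h hlt] with s hs
      exact hwz s hs.1.le hs.2
  · intro i t hi htm
    rcases le_or_gt t a with hta | hat
    · obtain ⟨xm, um, hxm, hum, hg⟩ := hx.jump i t hi ⟨htm.1, hta⟩
      refine ⟨xm, um, hxm.congr' ?_, hum, by rw [hwx t hta, hg]⟩
      filter_upwards [self_mem_nhdsWithin] with s hs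
      exact (hwx s (le_of_lt (lt_of_lt_of_le hs hta))).symm
    · rcases eq_or_lt_of_le htm.2 with rfl | hlt
      · obtain ⟨um, hum, hg⟩ := hjump i hi
        refine ⟨z t, um, ?_, hum, by rw [hwb, hg]⟩
        have hc : ContinuousOn z (Icc a t) := by
          simpa [uIcc_of_le hab.le] using hzac.continuousOn
        have hlim : Tendsto z (𝓝[<] t) (𝓝 (z t)) := by
          refine (hc t ⟨hab.le, le_rfl⟩).tendsto.mono_left ?_
          refine nhdsWithin_le_of_mem ?_
          filter_upwards [Ioo_mem_nhdsLT hab] with s hs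
          exact ⟨hs.1.le, hs.2.le⟩
        refine hlim.congr' ?_
        filter_upwards [Ioo_mem_nhdsLT hab] with s hs
        exact (hwz s hs.1.le hs.2).symm
      · exact absurd ⟨hat, hlt⟩ (Set.disjoint_left.1 (hd i) hi)

end ImpulsiveISS

namespace ImpulsiveISS

variable {N M p : ℕ} {S : System N M p} {t₀ : ℝ} {T : Fin p → Set ℝ}
  {u : ℝ → EuclideanSpace ℝ (Fin M)} {c : ℝ} {d : Fin p → ℝ}

/-! ### The accumulated decay rate -/

/-- The decay exponent accumulated by the flow and the impulses on `(s,t]`. -/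
noncomputable def decayExponent (T : Fin p → Set ℝ) (c : ℝ) (d : Fin p → ℝ) (t s : ℝ) : ℝ :=
  ∑ i, d i * (numImpulses (T i) t s : ℝ) + c * (t - s)

theorem IsImpulseTimes.numImpulses_add (hT : IsImpulseTimes t₀ T) (i : Fin p) {s m t : ℝ}
    (hs : t₀ ≤ s) (hsm : s ≤ m) (hmt : m ≤ t) :
    numImpulses (T i) t s = numImpulses (T i) t m + numImpulses (T i) m s := by
  have hfin : ∀ r t, t₀ ≤ r → (T i ∩ Ioc r t).Finite := fun r t hr =>
    (hT.finite i t).subset (inter_subset_inter_right _ (Ioc_subset_Ioc_left hr))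
  rw [numImpulses, numImpulses, numImpulses, ← ncard_union_eq _ (hfin m t (hs.trans hsm))
    (hfin s m hs), ← inter_union_distrib_left, union_comm, Ioc_union_Ioc_eq_Ioc hsm hmt]
  rw [Set.disjoint_left]
  exact fun r hr hr' => hr.2.1.not_ge hr'.2.2

theorem IsImpulseTimes.decayExponent_add (hT : IsImpulseTimes t₀ T) {s m t : ℝ}
    (hs : t₀ ≤ s) (hsm : s ≤ m) (hmt : m ≤ t) :
    decayExponent T c d t s = decayExponent T c d t m + decayExponent T c d m s := by
  simp only [decayExponent]
  rw [Finset.sum_congr rfl fun i _ => by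
    rw [hT.numImpulses_add i hs hsm hmt, Nat.cast_add, mul_add], Finset.sum_add_distrib]
  ring

theorem decayExponent_of_disjoint {s t : ℝ} (h : ∀ i, Disjoint (T i) (Ioc s t)) :
    decayExponent T c d t s = c * (t - s) := by
  have : ∀ i, numImpulses (T i) t s = 0 := fun i => by
    rw [numImpulses, (h i).inter_eq, ncard_empty]
  simp [decayExponent, this]

theorem IsImpulseTimes.decayExponent_of_mem (hT : IsImpulseTimes t₀ T) {i : Fin p} {s t : ℝ}
    (hst : s < t) (h : ∀ i, Disjoint (T i) (Ioo s t)) (ht : t ∈ T i) :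
    decayExponent T c d t s = d i + c * (t - s) := by
  have h1 : numImpulses (T i) t s = 1 := by
    rw [numImpulses, ← Ioo_insert_right hst, inter_insert_of_mem ht, (h i).inter_eq]
    simp
  have h2 : ∀ j, j ≠ i → numImpulses (T j) t s = 0 := fun j hj => by
    have htj : t ∉ T j := fun htj => hj (hT.eq_of_mem htj ht)
    rw [numImpulses, ← Ioo_insert_right hst, inter_insert_of_notMem htj, (h j).inter_eq,
      ncard_empty]
  rw [decayExponent, Finset.sum_eq_single i (fun j _ hj => by rw [h2 j hj]; simp) (by simp), h1]
  simp

/-- The jump maps see the left limit of the input, so the bound of the input has to pass to it. -/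
theorem norm_le_of_tendsto_left {r : ℝ≥0} {b : ℝ} (hb : t₀ < b)
    (hr : ∀ s ∈ Icc t₀ b, ‖u s‖₊ ≤ r) {v : EuclideanSpace ℝ (Fin M)}
    (hv : Tendsto u (𝓝[<] b) (𝓝 v)) : ‖v‖₊ ≤ r := by
  refine le_of_tendsto hv.nnnorm ?_
  filter_upwards [Ioo_mem_nhdsLT hb] with s hs
  exact hr s (Ioo_subset_Icc_self hs)

/-- Existence of a solution on `[t₀,H]`, with an estimate of the Lyapunov function at the final
time. Here `R` bounds the Lyapunov function at its threshold and after jumps from below the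
threshold. -/
theorem System.exists_solution_Icc {V : EuclideanSpace ℝ (Fin N) → ℝ} {γ : ℝ≥0 → ℝ≥0}
    (hT : IsImpulseTimes t₀ T) (hu : IsInput t₀ T u) (hV : LocallyLipschitz V)
    (hVnn : ∀ x, 0 ≤ V x) (hVbdd : ∀ B, ∃ R, ∀ x, V x ≤ B → ‖x‖ ≤ R) (hγ : Monotone γ)
    (hflow : ∀ᵐ x ∂(volume : Measure (EuclideanSpace ℝ (Fin N))), ∀ v : EuclideanSpace ℝ (Fin M),
      (γ ‖v‖₊ : ℝ) ≤ V x → fderiv ℝ V x (S.f x v) ≤ -c * V x)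
    (hjump : ∀ (i : Fin p) (x : EuclideanSpace ℝ (Fin N)) (v : EuclideanSpace ℝ (Fin M)),
      (γ ‖v‖₊ : ℝ) ≤ V x → V (S.g i x v) ≤ Real.exp (-(d i)) * V x)
    {H R : ℝ} {r : ℝ≥0} (hH : t₀ ≤ H) (hr : ∀ s ∈ Icc t₀ H, ‖u s‖₊ ≤ r) (hγR : (γ r : ℝ) ≤ R)
    (hreset : ∀ (i : Fin p) (x : EuclideanSpace ℝ (Fin N)) (v : EuclideanSpace ℝ (Fin M)),
      ‖v‖₊ ≤ r → V x ≤ γ r → V (S.g i x v) ≤ R) (x₀ : EuclideanSpace ℝ (Fin N)) :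
    ∃ x : ℝ → EuclideanSpace ℝ (Fin N), x t₀ = x₀ ∧ S.IsSolutionOn T u x (Icc t₀ H) ∧
      (V (x H) ≤ Real.exp (-decayExponent T c d H t₀) * V x₀ ∨
        ∃ s ∈ Icc t₀ H, V (x H) ≤ Real.exp (-decayExponent T c d H s) * R) := by
  have hself : ∀ t, decayExponent T c d t t = 0 := fun t => by
    rw [decayExponent_of_disjoint (by simp)]; ring
  refine hT.induction (P := fun b => ∃ x : ℝ → EuclideanSpace ℝ (Fin N), x t₀ = x₀ ∧
      S.IsSolutionOn T u x (Icc t₀ b) ∧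
      (V (x b) ≤ Real.exp (-decayExponent T c d b t₀) * V x₀ ∨
        ∃ s ∈ Icc t₀ b, V (x b) ≤ Real.exp (-decayExponent T c d b s) * R)) ?_ ?_ H hH le_rfl
  · refine ⟨fun _ => x₀, rfl, ⟨?_, ?_, ?_⟩, Or.inl (by simp [hself])⟩
    · exact fun _ _ _ _ _ _ => (LipschitzWith.const x₀).lipschitzOnWith.absolutelyContinuousOnInterval
    · have h1 : ∀ᵐ t : ℝ, t ≠ t₀ := by simp [ae_iff, measure_singleton]
      filter_upwards [h1] with t ht htm
      exact absurd (by simpa using htm) ht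
    · intro i t ht htm
      exact absurd (hT.lt_of_mem ht) htm.2.not_gt
  · rintro a b ha hab hbH hd ⟨x, hx0, hx, hest⟩
    obtain ⟨z, hza, hzac, hzd, hzest⟩ := exists_solution_of_lyapunov (f := S.f) (u := u)
      (C := (r : ℝ)) (ρ := (γ r : ℝ)) (G := fun v => (γ ‖v‖₊ : ℝ)) hab.le S.locallyLipschitz_f
      (fun s hs => by exact_mod_cast hr s ⟨ha.trans hs.1, hs.2.trans hbH⟩)
      (hu.aemeasurable_restrict ha) hV hVnn hVbdd hflow
      (fun s hs => by exact_mod_cast hγ (hr s ⟨ha.trans hs.1, hs.2.trans hbH⟩)) (x a)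
    -- When the last interval contributes its full factor, either alternative at a carries over to b
    -- by additivity of the exponent.
    have hchain : ∀ {q k : ℝ}, 0 ≤ k → q ≤ k * V (x a) →
        k = Real.exp (-decayExponent T c d b a) →
        q ≤ Real.exp (-decayExponent T c d b t₀) * V x₀ ∨
          ∃ s ∈ Icc t₀ b, q ≤ Real.exp (-decayExponent T c d b s) * R := by
      intro q k hk hq hke
      have hstep : ∀ s, t₀ ≤ s → s ≤ a → ∀ e, V (x a) ≤ Real.exp (-decayExponent T c d a s) * e →
          q ≤ Real.exp (-decayExponent T c d b s) * e := by
        intro s hs hsa e he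
        rw [hT.decayExponent_add hs hsa hab.le, neg_add, Real.exp_add, mul_assoc, ← hke]
        exact hq.trans (mul_le_mul_of_nonneg_left he hk)
      rcases hest with h | ⟨s, hs, h⟩
      · exact Or.inl (hstep t₀ le_rfl ha _ h)
      · exact Or.inr ⟨s, ⟨hs.1, hs.2.trans hab.le⟩, hstep s hs.1 hs.2 _ h⟩
    by_cases hbT : ∃ i, b ∈ T i
    · obtain ⟨i, hi⟩ := hbT
      obtain ⟨um, hum⟩ := hu.leftLimit i b hi
      have humr : ‖um‖₊ ≤ r := norm_le_of_tendsto_left (ha.trans_lt hab)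
        (fun s hs => hr s ⟨hs.1, hs.2.trans hbH⟩) hum
      obtain ⟨w, hwx, hwb, hw⟩ := hx.extend ha hab hd hza hzac hzd (xb := S.g i (z b) um)
        (fun h => absurd hi (h i)) (fun j hj => by
          rw [hT.eq_of_mem hj hi]; exact ⟨um, hum, rfl⟩)
      refine ⟨w, by rw [hwx ⟨le_rfl, ha⟩, hx0], hw, ?_⟩
      rw [hwb]
      -- A jump from below the threshold restarts the estimate at s = b, with exponent zero and
      -- bound R. From above it, the jump inequality contributes the factor exp(-dᵢ).
      rcases le_or_gt (V (z b)) (γ r) with hle | hgt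
      · exact Or.inr ⟨b, ⟨ha.trans hab.le, le_rfl⟩, by
          rw [hself, neg_zero, Real.exp_zero, one_mul]; exact hreset i _ _ humr hle⟩
      · have hj : V (S.g i (z b) um) ≤ Real.exp (-(d i)) * V (z b) :=
          hjump i _ _ (le_trans (by exact_mod_cast hγ humr) hgt.le)
        rcases hzest with h | ⟨τ, hτ, h⟩
        · refine hchain (k := Real.exp (-(d i)) * Real.exp (-c * (b - a))) (by positivity) ?_ ?_
          · rw [mul_assoc]
            exact hj.trans (mul_le_mul_of_nonneg_left h (Real.exp_pos _).le)
          · rw [hT.decayExponent_of_mem hab hd hi, ← Real.exp_add]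
            ring_nf
        -- τ = b would put V(z(b)) at or below the threshold. So τ < b, and the impulse at b is
        -- counted in (τ,b].
        · rcases eq_or_lt_of_le hτ.2 with rfl | hτb
          · simp only [sub_self, mul_zero, Real.exp_zero, one_mul] at h
            exact absurd h hgt.not_ge
          · refine Or.inr ⟨τ, ⟨ha.trans hτ.1, hτ.2⟩, hj.trans ?_⟩
            have hd' : ∀ j, Disjoint (T j) (Ioo τ b) := fun j =>
              (hd j).mono_right (Ioo_subset_Ioo_left hτ.1)
            rw [hT.decayExponent_of_mem hτb hd' hi, neg_add, Real.exp_add, mul_assoc, ← neg_mul]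
            gcongr
            exact h.trans (by gcongr)
    · push Not at hbT
      obtain ⟨w, hwx, hwb, hw⟩ := hx.extend ha hab hd hza hzac hzd (xb := z b)
        (fun _ => rfl) (fun j hj => absurd hj (hbT j))
      refine ⟨w, by rw [hwx ⟨le_rfl, ha⟩, hx0], hw, ?_⟩
      rw [hwb]
      have hdis := disjoint_Ioc_of_disjoint_Ioo hd (Or.inr ⟨rfl, hbT⟩)
      rcases hzest with h | ⟨τ, hτ, h⟩
      · refine hchain (Real.exp_pos _).le h ?_
        rw [decayExponent_of_disjoint hdis, neg_mul]
      · refine Or.inr ⟨τ, ⟨ha.trans hτ.1, hτ.2⟩, h.trans ?_⟩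
        rw [decayExponent_of_disjoint fun j => (hdis j).mono_right (Ioc_subset_Ioc_left hτ.1),
          neg_mul]
        gcongr

theorem IsInput.nnnorm_le_supNorm (hu : IsInput t₀ T u) {s t : ℝ} (hs : s ∈ Icc t₀ t) :
    ‖u s‖₊ ≤ supNorm u t₀ t := by
  obtain ⟨C, hC⟩ := hu.bounded t
  -- Local boundedness of the input is essential: the supremum of an unbounded family in `ℝ≥0`
  -- defaults to 0.
  refine le_ciSup (f := fun s : Icc t₀ t => ‖u s‖₊) ⟨C.toNNReal, ?_⟩ ⟨s, hs⟩
  rintro _ ⟨s, rfl⟩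
  simp only [← norm_toNNReal]
  exact Real.toNNReal_le_toNNReal (hC s s.2)

/-- The solutions on the intervals `[t₀,t]` fit together. -/
theorem System.exists_solution_Ici (hT : IsImpulseTimes t₀ T) (hu : IsInput t₀ T u)
    {x₀ : EuclideanSpace ℝ (Fin N)} {Q : ℝ → EuclideanSpace ℝ (Fin N) → Prop}
    (h : ∀ t, t₀ ≤ t → ∃ x : ℝ → EuclideanSpace ℝ (Fin N), x t₀ = x₀ ∧
      S.IsSolutionOn T u x (Icc t₀ t) ∧ Q t (x t)) :
    ∃ x : ℝ → EuclideanSpace ℝ (Fin N), x t₀ = x₀ ∧ S.IsSolutionOn T u x (Ici t₀) ∧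
      (∀ (b : ℝ) (y : ℝ → EuclideanSpace ℝ (Fin N)), y t₀ = x₀ →
        S.IsSolutionOn T u y (Ico t₀ b) → EqOn y x (Ico t₀ b)) ∧
      ∀ t, t₀ ≤ t → Q t (x t) := by
  -- The estimate involves the supremum of the input up to t, so each t has its own solution on
  -- [t₀,t]. By uniqueness they agree, and the diagonal t ↦ X t t is a global solution that inherits
  -- every estimate.
  choose! X hX0 hX hQ using h
  have heq : ∀ b, t₀ ≤ b → EqOn (X b) (fun t => X t t) (Icc t₀ b) := by
    intro b hb t ht
    exact (((hX b hb).mono (Icc_subset_Icc_right ht.2)).eqOn hT hu (hX t ht.1)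
      (by rw [hX0 b hb, hX0 t ht.1])) ⟨ht.1, le_rfl⟩
  have hsol : ∀ b, t₀ ≤ b → S.IsSolutionOn T u (fun t => X t t) (Icc t₀ b) := fun b hb =>
    (hX b hb).congr hT (heq b hb)
  refine ⟨fun t => X t t, hX0 t₀ le_rfl, isSolutionOn_Ici hsol, ?_, fun t ht => hQ t ht⟩
  intro b y hy0 hy t ht
  have hy' : S.IsSolutionOn T u y (Icc t₀ t) := hy.mono fun s hs => ⟨hs.1, hs.2.trans_lt ht.2⟩
  exact (hy'.eqOn hT hu (hsol t ht.1) (by rw [hy0, hX0 t₀ le_rfl])) ⟨ht.1, le_rfl⟩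

/-! ### Comparison functions of the Lyapunov function and the jump maps -/

section Comparison

variable {V : EuclideanSpace ℝ (Fin N) → ℝ}

theorem exists_norm_le_of_radiallyUnbounded
    (hV : Tendsto V (Bornology.cobounded (EuclideanSpace ℝ (Fin N))) atTop) (B : ℝ) :
    ∃ R, ∀ x, V x ≤ B → ‖x‖ ≤ R := by
  have hb : Bornology.IsBounded {x | V x ≤ B} := by
    rw [Bornology.isBounded_def]
    filter_upwards [hV.eventually_gt_atTop B] with x hx
    simpa using hx
  obtain ⟨R, hR⟩ := hb.exists_norm_le
  exact ⟨R, fun x hx => hR x hx⟩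

/-- Properness bounds the norm on sublevel sets. For small values, V has a positive minimum on the
compact set where V ≤ 1 and ‖x‖ ≥ ε, if it is nonempty; below half of this minimum, and below 1, the
norm is less than ε. -/
theorem exists_isClassKInf_norm_le (hVc : Continuous V) (hpos : ∀ x, x ≠ 0 → 0 < V x)
    (hVbdd : ∀ B, ∃ R, ∀ x, V x ≤ B → ‖x‖ ≤ R) :
    ∃ κ, IsClassKInf κ ∧ ∀ x, ‖x‖₊ ≤ κ (V x).toNNReal := by
  refine exists_isClassKInf_comp_ge (fun x => (V x).toNNReal) (fun x => ‖x‖₊) (fun r => ?_)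
    fun ε hε => ?_
  · obtain ⟨R, hR⟩ := hVbdd r
    refine ⟨R.toNNReal, fun x hx => ?_⟩
    rw [← norm_toNNReal]
    exact Real.toNNReal_le_toNNReal (hR x (Real.toNNReal_le_iff_le_coe.1 hx))
  · have hcl : IsClosed ({x | V x ≤ 1} ∩ {x | (ε : ℝ) ≤ ‖x‖}) :=
      (isClosed_le hVc continuous_const).inter (isClosed_le continuous_const continuous_norm)
    obtain ⟨R, hR⟩ := hVbdd 1
    have hcomp : IsCompact ({x | V x ≤ 1} ∩ {x | (ε : ℝ) ≤ ‖x‖}) :=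
      Metric.isCompact_of_isClosed_isBounded hcl
        ((isBounded_iff_forall_norm_le.2 ⟨R, hR⟩).subset inter_subset_left)
    rcases ({x | V x ≤ 1} ∩ {x | (ε : ℝ) ≤ ‖x‖}).eq_empty_or_nonempty with he | hne
    · refine ⟨1, one_pos, fun x hx => ?_⟩
      by_contra! hlt
      have hx1 : V x ≤ 1 := by simpa using Real.toNNReal_le_iff_le_coe.1 hx
      have : x ∈ ({x | V x ≤ 1} ∩ {x | (ε : ℝ) ≤ ‖x‖}) := ⟨hx1, by exact_mod_cast hlt.le⟩
      rw [he] at this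
      exact this
    · obtain ⟨x₁, hx₁, hmin⟩ := hcomp.exists_isMinOn hne hVc.continuousOn
      have hx₁0 : 0 < V x₁ := hpos x₁ (norm_pos_iff.1 (lt_of_lt_of_le (by exact_mod_cast hε) hx₁.2))
      refine ⟨(V x₁ / 2).toNNReal, by simpa using hx₁0, fun x hx => ?_⟩
      by_contra! hlt
      have hxV : V x ≤ V x₁ / 2 := by
        have := Real.toNNReal_le_iff_le_coe.1 hx
        rwa [Real.coe_toNNReal _ (by positivity)] at this
      have hx1 : V x ≤ 1 := by
        have : V x₁ ≤ 1 := hx₁.1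
        linarith
      have : V x₁ ≤ V x := hmin ⟨hx1, by exact_mod_cast hlt.le⟩
      linarith

theorem exists_isClassKInf_le_norm (hVc : Continuous V) (h0 : V 0 = 0) :
    ∃ α, IsClassKInf α ∧ ∀ x, (V x).toNNReal ≤ α ‖x‖₊ := by
  refine exists_isClassKInf_comp_ge (fun x => ‖x‖₊) (fun x => (V x).toNNReal) (fun r => ?_)
    fun ε hε => ?_
  · obtain ⟨C, hC⟩ := (isCompact_closedBall (0 : EuclideanSpace ℝ (Fin N)) r)
      |>.exists_bound_of_continuousOn hVc.continuousOn
    refine ⟨C.toNNReal, fun x hx => Real.toNNReal_le_toNNReal ((le_abs_self _).trans ?_)⟩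
    exact hC x (by simpa using (show ‖x‖ ≤ r by exact_mod_cast hx))
  · have hev : ∀ᶠ x in 𝓝 (0 : EuclideanSpace ℝ (Fin N)), V x < ε :=
      hVc.continuousAt.eventually (gt_mem_nhds (by rw [h0]; exact_mod_cast hε))
    obtain ⟨δ, hδ, hball⟩ := Metric.eventually_nhds_iff_ball.1 hev
    refine ⟨(δ / 2).toNNReal, by simpa using hδ, fun x hx => ?_⟩
    rw [Real.toNNReal_le_iff_le_coe]
    refine (hball x ?_).le
    rw [mem_ball_zero_iff]
    have : (‖x‖₊ : ℝ) ≤ δ / 2 := by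
      have := NNReal.coe_le_coe.2 hx
      rwa [Real.coe_toNNReal _ (by positivity)] at this
    rw [coe_nnnorm] at this
    linarith

/-- After a jump from below the threshold, `V` is bounded by a comparison function of the bound of
the input. -/
theorem exists_isClassKInf_jump_le
    (hg_bdd : ∀ (i : Fin p)
      (B : Set (EuclideanSpace ℝ (Fin N) × EuclideanSpace ℝ (Fin M))), Bornology.IsBounded B →
      Bornology.IsBounded ((fun z => S.g i z.1 z.2) '' B))
    (hg_cont : ∀ i : Fin p, ContinuousAt
      (fun z : EuclideanSpace ℝ (Fin N) × EuclideanSpace ℝ (Fin M) => S.g i z.1 z.2) (0, 0))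
    (hg_zero : ∀ i, S.g i 0 0 = 0) (hVc : Continuous V) (h0 : V 0 = 0)
    (hVbdd : ∀ B, ∃ R, ∀ x, V x ≤ B → ‖x‖ ≤ R) {κ γ : ℝ≥0 → ℝ≥0} (hκ : IsClassKInf κ)
    (hκV : ∀ x, ‖x‖₊ ≤ κ (V x).toNNReal) (hγ : IsClassKInf γ) :
    ∃ α, IsClassKInf α ∧ ∀ (r : ℝ≥0) (i : Fin p) (x : EuclideanSpace ℝ (Fin N))
      (v : EuclideanSpace ℝ (Fin M)), ‖v‖₊ ≤ r → V x ≤ γ r → V (S.g i x v) ≤ α r := by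
  -- All admissible tuples (r,i,x,v) form one index set, with r as the controlling quantity; this
  -- makes α uniform in i, x and v.
  suffices h : ∃ α, IsClassKInf α ∧
      ∀ q : {q : ℝ≥0 × Fin p × EuclideanSpace ℝ (Fin N) × EuclideanSpace ℝ (Fin M) //
        ‖q.2.2.2‖₊ ≤ q.1 ∧ V q.2.2.1 ≤ γ q.1},
      (V (S.g q.1.2.1 q.1.2.2.1 q.1.2.2.2)).toNNReal ≤ α q.1.1 by
    obtain ⟨α, hα, hle⟩ := h
    refine ⟨α, hα, fun r i x v hv hx => ?_⟩
    exact Real.toNNReal_le_iff_le_coe.1 (hle ⟨(r, i, x, v), hv, hx⟩)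
  refine exists_isClassKInf_comp_ge _ _ ?_ ?_
  · intro r
    obtain ⟨R, hR⟩ := hVbdd (γ r)
    have hbd : ∀ i, ∃ C : ℝ≥0, ∀ x v, ‖x‖ ≤ R → ‖v‖ ≤ r → V (S.g i x v) ≤ C := by
      intro i
      have hb : Bornology.IsBounded (Metric.closedBall (0 : EuclideanSpace ℝ (Fin N)) R ×ˢ
          Metric.closedBall (0 : EuclideanSpace ℝ (Fin M)) r) :=
        Metric.isBounded_closedBall.prod Metric.isBounded_closedBall
      obtain ⟨R', hR'⟩ := (hg_bdd i _ hb).exists_norm_le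
      obtain ⟨C, hC⟩ := (isCompact_closedBall (0 : EuclideanSpace ℝ (Fin N)) R')
        |>.exists_bound_of_continuousOn hVc.continuousOn
      refine ⟨C.toNNReal, fun x v hx hv => ?_⟩
      refine (le_abs_self _).trans ((hC _ ?_).trans (Real.le_coe_toNNReal C))
      exact mem_closedBall_zero_iff.2 (hR' _ ⟨(x, v), ⟨by simpa using hx, by simpa using hv⟩, rfl⟩)
    choose C hC using hbd
    refine ⟨∑ i, C i, ?_⟩
    rintro ⟨⟨r', i, x, v⟩, hv, hx⟩ hr'
    simp only at hv hx hr'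
    have h1 : ‖x‖ ≤ R := hR x (hx.trans (by exact_mod_cast hγ.strictMono.monotone hr'))
    have h2 : ‖v‖ ≤ r := by exact_mod_cast hv.trans hr'
    rw [Real.toNNReal_le_iff_le_coe]
    refine (hC i x v h1 h2).trans ?_
    exact_mod_cast Finset.single_le_sum (f := C) (fun _ _ => zero_le) (Finset.mem_univ i)
  · intro ε hε
    have hev : ∀ᶠ z in 𝓝 ((0, 0) : EuclideanSpace ℝ (Fin N) × EuclideanSpace ℝ (Fin M)),
        ∀ i, V (S.g i z.1 z.2) < ε := by
      rw [eventually_all]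
      intro i
      have hc : ContinuousAt (fun z : EuclideanSpace ℝ (Fin N) × EuclideanSpace ℝ (Fin M) =>
          V (S.g i z.1 z.2)) (0, 0) := ContinuousAt.comp (g := V) hVc.continuousAt (hg_cont i)
      refine hc.eventually (gt_mem_nhds ?_)
      simp only [hg_zero, h0]
      exact_mod_cast hε
    obtain ⟨δ, hδ, hball⟩ := Metric.eventually_nhds_iff_ball.1 hev
    have hκγ : ∀ᶠ r in 𝓝 (0 : ℝ≥0), κ (γ r) < δ.toNNReal :=
      (hκ.comp hγ).continuous.continuousAt.eventually
        (gt_mem_nhds (by simpa [hγ.zero, hκ.zero] using hδ))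
    have hid : ∀ᶠ r in 𝓝 (0 : ℝ≥0), r < δ.toNNReal := gt_mem_nhds (by simpa using hδ)
    -- For this r the constraints give ‖x‖ ≤ κ(γ(r)) < δ and ‖v‖ ≤ r < δ, so (x,v) is in the ball
    -- supplied by continuity at the origin.
    have hex : ∃ r : ℝ≥0, 0 < r ∧ κ (γ r) < δ.toNNReal ∧ r < δ.toNNReal := by
      have : ∀ᶠ r in 𝓝[>] (0 : ℝ≥0), 0 < r ∧ κ (γ r) < δ.toNNReal ∧ r < δ.toNNReal :=
        eventually_mem_nhdsWithin.and ((hκγ.and hid).filter_mono nhdsWithin_le_nhds)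
      exact this.exists
    obtain ⟨r, hr0, hr1, hr2⟩ := hex
    refine ⟨r, hr0, ?_⟩
    rintro ⟨⟨r', i, x, v⟩, hv, hx⟩ hr'
    simp only at hv hx hr'
    rw [Real.toNNReal_le_iff_le_coe]
    refine (hball (x, v) ?_ i).le
    have hx' : ‖x‖₊ < δ.toNNReal := by
      refine ((hκV x).trans (hκ.strictMono.monotone ?_)).trans_lt hr1
      exact (Real.toNNReal_le_iff_le_coe.2 hx).trans (hγ.strictMono.monotone hr')
    have hv' : ‖v‖₊ < δ.toNNReal := (hv.trans hr').trans_lt hr2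
    rw [Metric.mem_ball, Prod.dist_eq, max_lt_iff, dist_zero_right, dist_zero_right]
    exact ⟨by simpa using Real.lt_toNNReal_iff_coe_lt.1 hx',
      by simpa using Real.lt_toNNReal_iff_coe_lt.1 hv'⟩

end Comparison

/-- The `KL` function obtained from exponential decay of the Lyapunov function. -/
theorem isClassKL_exp {κ α : ℝ≥0 → ℝ≥0} (hκ : IsClassKInf κ) (hα : IsClassKInf α) (μ : ℝ)
    {lam : ℝ} (hlam : 0 < lam) :
    IsClassKL fun r t => κ ((Real.exp (μ - lam * t)).toNNReal * α r) := by
  have hpos : ∀ t : ℝ≥0, 0 < (Real.exp (μ - lam * t)).toNNReal := fun t => by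
    simpa using Real.exp_pos _
  refine ⟨?_, fun t => ?_, fun r => ?_, fun r => ?_⟩
  · have hα' := hα.continuous
    refine hκ.continuous.comp (Continuous.mul ?_ (hα'.comp continuous_fst))
    exact continuous_real_toNNReal.comp (by fun_prop)
  · exact (hκ.comp ((isClassKInf_const_mul (hpos t)).comp hα)).isClassK
  · intro t t' h
    refine hκ.strictMono.monotone (mul_le_mul_left (Real.toNNReal_le_toNNReal ?_) _)
    have : (t : ℝ) ≤ t' := h
    gcongr
  · have h1 : Tendsto (fun t : ℝ≥0 => Real.exp (μ - lam * t)) atTop (𝓝 0) := by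
      refine Real.tendsto_exp_atBot.comp ?_
      refine tendsto_atBot_add_const_left _ μ (tendsto_neg_atTop_atBot.comp ?_)
      exact (NNReal.tendsto_coe_atTop.2 tendsto_id).const_mul_atTop hlam
    have h2 : Tendsto (fun t : ℝ≥0 => (Real.exp (μ - lam * t)).toNNReal * α r) atTop (𝓝 0) := by
      have := ((continuous_real_toNNReal.tendsto 0).comp h1).mul_const (α r)
      simpa using this
    have := (hκ.continuous.tendsto 0).comp h2
    rwa [hκ.zero] at this

end ImpulsiveISS

/-! ### Proof of uniform ISS -/

theorem theorem1 {N M p : ℕ} (S : ImpulsiveISS.System N M p) (t₀ : ℝ)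
    (hg_bdd : ∀ (i : Fin p)
      (B : Set (EuclideanSpace ℝ (Fin N) × EuclideanSpace ℝ (Fin M))), Bornology.IsBounded B →
      Bornology.IsBounded ((fun z => S.g i z.1 z.2) '' B))
    (hg_cont : ∀ i : Fin p, ContinuousAt
      (fun z : EuclideanSpace ℝ (Fin N) × EuclideanSpace ℝ (Fin M) => S.g i z.1 z.2) (0, 0))
    (V : EuclideanSpace ℝ (Fin N) → ℝ) (c : ℝ) (d : Fin p → ℝ) (hd : ∀ i, d i ≠ 0)
    (hV : S.IsCandidateLyapunov V c d) (μ lam : ℝ) (hμ : 0 < μ) (hlam : 0 < lam) :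
    S.IsUniformlyISSOn t₀ (ImpulsiveISS.dwellClass t₀ c d μ lam) := by
  obtain ⟨γ, hγ, hflow, hjump⟩ := hV.decay
  have hVc := hV.locallyLipschitz.continuous
  have hVnn : ∀ x, 0 ≤ V x := fun x => by
    by_cases hx : x = 0
    · rw [hx, hV.zero]
    · exact (hV.pos x hx).le
  have hVbdd := ImpulsiveISS.exists_norm_le_of_radiallyUnbounded hV.radiallyUnbounded
  -- At the origin V(0) = 0 = γ(0), so the jump inequality applies and forces V(gᵢ(0,0)) ≤ 0.
  have hg_zero : ∀ i, S.g i 0 0 = 0 := by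
    intro i
    by_contra hne
    have h := hjump i 0 0 (by simp [hγ.zero, hV.zero])
    rw [hV.zero, mul_zero] at h
    exact h.not_gt (hV.pos _ hne)
  obtain ⟨κ, hκ, hκV⟩ := ImpulsiveISS.exists_isClassKInf_norm_le hVc hV.pos hVbdd
  obtain ⟨α, hα, hαV⟩ := ImpulsiveISS.exists_isClassKInf_le_norm hVc hV.zero
  obtain ⟨η, hη, hηV⟩ := ImpulsiveISS.exists_isClassKInf_jump_le (S := S) hg_bdd hg_cont hg_zero
    hVc hV.zero hVbdd hκ hκV hγ
  have hexpμ : 0 < (Real.exp μ).toNNReal := by simpa using Real.exp_pos μ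
  refine ⟨fun r t => κ ((Real.exp (μ - lam * t)).toNNReal * α r),
    fun r => κ ((Real.exp μ).toNNReal * max (γ r) (η r)),
    ImpulsiveISS.isClassKL_exp hκ hα μ hlam,
    hκ.comp ((ImpulsiveISS.isClassKInf_const_mul hexpμ).comp (hγ.max hη)), ?_⟩
  rintro T ⟨hT, hdwell⟩ x₀ u hu
  -- The dwell-time condition, rearranged and exponentiated.
  have hexp : ∀ s t, t₀ ≤ s → s ≤ t →
      Real.exp (-ImpulsiveISS.decayExponent T c d t s) ≤ Real.exp (μ - lam * (t - s)) := by
    intro s t hs hst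
    have := hdwell s t hs hst
    rw [Real.exp_le_exp, ImpulsiveISS.decayExponent]
    linarith
  obtain ⟨x, hx0, hx, huniq, hest⟩ := ImpulsiveISS.System.exists_solution_Ici (S := S) hT hu
    (Q := fun t q =>
      V q ≤ Real.exp (-ImpulsiveISS.decayExponent T c d t t₀) * V x₀ ∨
        ∃ s ∈ Icc t₀ t, V q ≤ Real.exp (-ImpulsiveISS.decayExponent T c d t s) *
          ((max (γ (ImpulsiveISS.supNorm u t₀ t)) (η (ImpulsiveISS.supNorm u t₀ t)) : ℝ≥0) : ℝ))
    (fun t ht => ImpulsiveISS.System.exists_solution_Icc hT hu hV.locallyLipschitz hVnn hVbdd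
      hγ.strictMono.monotone hflow hjump
      (R := ((max (γ (ImpulsiveISS.supNorm u t₀ t)) (η (ImpulsiveISS.supNorm u t₀ t)) : ℝ≥0) : ℝ))
      ht (fun s hs => hu.nnnorm_le_supNorm hs)
      (NNReal.coe_le_coe.2 (le_max_left _ _))
      (fun i x v hv hxV => (hηV _ i x v hv hxV).trans (NNReal.coe_le_coe.2 (le_max_right _ _))) x₀)
  refine ⟨x, hx0, hx, huniq, fun t ht => ?_⟩
  have hmono := hκ.strictMono.monotone
  refine (hκV (x t)).trans ?_
  rcases hest t ht with h | ⟨s, hs, h⟩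
  · refine le_max_of_le_left (hmono (Real.toNNReal_le_iff_le_coe.2 ?_))
    rw [NNReal.coe_mul, Real.coe_toNNReal _ (Real.exp_pos _).le,
      Real.coe_toNNReal _ (sub_nonneg.2 ht), hx0]
    refine h.trans (mul_le_mul (hexp t₀ t le_rfl ht) ?_ (hVnn _) (Real.exp_pos _).le)
    exact Real.toNNReal_le_iff_le_coe.1 (hαV x₀)
  · refine le_max_of_le_right (hmono (Real.toNNReal_le_iff_le_coe.2 ?_))
    rw [NNReal.coe_mul, Real.coe_toNNReal _ (Real.exp_pos _).le]
    refine h.trans (mul_le_mul_of_nonneg_right ?_ (NNReal.coe_nonneg _))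
    -- The restart time s is unknown, so exp(-λ (t - s)) is bounded by 1; this leaves the factor exp
    -- μ in the gain.
    refine (hexp s t hs.1 hs.2).trans (Real.exp_le_exp.2 ?_)
    have := mul_nonneg hlam.le (sub_nonneg.2 hs.2)
    linarith
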